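/- Let $n\ge 1$, let $\mathbb H_n$ be the Siegel upper half space of symmetric $Z=X+iY\in M_n(\mathbb C)$ with $Y>0$, and let $(\rho,V)$ be an irreducible finite-dimensional rational representation of $\mathrm{GL}_n(\mathbb C)$ whose highest weight is the tuple of integers $\lambda_1\ge\dots\ge\lambda_n$. Fix a $U(n)$-invariant inner product on $V$, with norm $\|v\|=\langle v,v\rangle^{1/2}$. For $F:\mathbb H_n\to V$ and $g=\begin{pmatrix}A&B\\C&D\end{pmatrix}\in\mathrm{Sp}_{2n}(\mathbb R)$ put $$(F|_\rho g)(Z)=\rho(CZ+D)^{-1}F\big((AZ+B)(CZ+D)^{-1}\big).$$ For an integer $p\ge0$ let $T_n^p$ be the set of families $b=(b_{ij})_{1\le i\le j\le n}$ of non-negative integers with $\sum b_{ij}\le p$, and put $[M]^b=\prod_{i\le j}m_{ij}^{b_{ij}}$ for a symmetric matrix $M=(m_{ij})$. Let $N^p(\mathbb H_n)$ be the space of functions $f(Z)=\sum_{b\in T_n^p}G_b(Z)[Y^{-1}]^b$ with $G_b$ holomorphic on $\mathbb H_n$. Such an $f$ has a nice Fourier expansion if there are an integer $N\ge1$ and complex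 numbers $a_b(S)$ with $$f(Z)=\sum_{b\in T_n^p}\ \sum_{\substack{S\in\frac1N M_n^{\mathrm{sym}}(\mathbb Z)\\ S\ge0}}a_b(S)\,e^{2\pi i\,\mathrm{Tr}(SZ)}\,[Y^{-1}]^b,$$ the sum converging absolutely, and uniformly on compact subsets of $\mathbb H_n$. A congruence subgroup of $\mathrm{Sp}_{2n}(\mathbb Q)$ is a subgroup commensurable with $\mathrm{Sp}_{2n}(\mathbb Z)$ that contains a principal congruence subgroup of $\mathrm{Sp}_{2n}(\mathbb Z)$. A function $F:\mathbb H_n\to V$ is a nearly holomorphic Siegel modular form of weight $\rho$ if there are a congruence subgroup $\Gamma$ and a $p\ge0$ such that $F|_\rho\gamma=F$ for all $\gamma\in\Gamma$ and such that, for all $g\in\mathrm{Sp}_{2n}(\mathbb Q)$ and all linear $L:V\to\mathbb C$, the function $L\circ(F|_\rho g)$ lies in $N^p(\mathbb H_n)$ and has a nice Fourier expansion (with the same $p$). Theorem. For every nearly holomorphic Siegel modular form $F$ of weight $\rho$ there is a constant $C_F$ such that for all $Z=X+iY\in\mathbb H_n$ $$\|\rho(Y^{1/2})F(Z)\|\le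 C_F\prod_{i=1}^n\big(\mu_i(Y)^{\lambda_1/2}+\mu_i(Y)^{-\lambda_1/2}\big),$$ where $Y^{1/2}$ is the positive definite square root of $Y$ and $\mu_1(Y),\dots,\mu_n(Y)$ are the eigenvalues of $Y$, with multiplicity. -/

import Mathlib

open Matrix

namespace SiegelModular

/-! ### Real positive definite matrices -/

/-- A real matrix is positive definite iff it is so as a complex matrix. -/
theorem posDef_map_ofReal_iff {n : ℕ} {Y : Matrix (Fin n) (Fin n) ℝ} :
    (open scoped ComplexOrder in (Y.map ((↑) : ℝ → ℂ)).PosDef) ↔ Y.PosDef := by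
  open scoped ComplexOrder MatrixOrder in
  constructor
  · intro h
    refine PosDef.of_dotProduct_mulVec_pos ?_ ?_
    · ext i j
      have := congrFun (congrFun h.1 i) j
      simpa [Matrix.conjTranspose_apply] using this
    · intro x hx
      have hx' : (fun i => (x i : ℂ)) ≠ 0 := by
        intro h0
        apply hx
        funext i
        simpa using congrFun h0 i
      have := h.dotProduct_mulVec_pos hx'
      have e : star (fun i => (x i : ℂ)) ⬝ᵥ (Y.map ((↑) : ℝ → ℂ) *ᵥ fun i => (x i : ℂ))
          = ((star x ⬝ᵥ (Y *ᵥ x) : ℝ) : ℂ) := by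
        simp [dotProduct, mulVec]
      rw [e] at this
      exact_mod_cast this
  · intro h
    have hs : (CFC.sqrt Y)ᴴ * CFC.sqrt Y = Y := by
      have h1 : (CFC.sqrt Y)ᴴ = CFC.sqrt Y := (CFC.sqrt_nonneg Y).posSemidef.1
      rw [h1]
      exact CFC.sqrt_mul_sqrt_self Y h.posSemidef.nonneg
    have hu : IsUnit (CFC.sqrt Y) := (CFC.isUnit_sqrt_iff Y h.posSemidef.nonneg).2 h.isUnit
    have hu' : IsUnit ((CFC.sqrt Y).map ((↑) : ℝ → ℂ)) :=
      hu.map (Complex.ofRealHom.mapMatrix (m := Fin n))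
    have e : Y.map ((↑) : ℝ → ℂ)
        = ((CFC.sqrt Y).map ((↑) : ℝ → ℂ))ᴴ * (CFC.sqrt Y).map ((↑) : ℝ → ℂ) := by
      conv_lhs => rw [← hs]
      ext i j
      simp [Matrix.mul_apply]
    rw [e]
    exact PosDef.conjTranspose_mul_self _ (Matrix.mulVec_injective_iff_isUnit.2 hu')

open scoped MatrixOrder in
/-- The positive definite square root `Y^{1/2}` of a positive definite real matrix `Y`, as an
element of `GL_n(ℂ)`. -/
noncomputable def posDefSqrt {n : ℕ} (Y : Matrix (Fin n) (Fin n) ℝ) (hY : Y.PosDef) :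
    GL (Fin n) ℂ :=
  (((CFC.isUnit_sqrt_iff Y hY.posSemidef.nonneg).2 hY.isUnit).map
    (Complex.ofRealHom.mapMatrix (m := Fin n))).unit

/-! ### The Siegel upper half space and the action of the symplectic group -/

/-- The Siegel upper half space `ℍ_n`, as a set of complex matrices. -/
def siegelSet (n : ℕ) : Set (Matrix (Fin n) (Fin n) ℂ) :=
  {Z | Zᵀ = Z ∧ (Z.map Complex.im).PosDef}

/-- The Siegel upper half space `ℍ_n` of degree `n`. -/
abbrev SiegelSpace (n : ℕ) : Type := siegelSet n

/-- The imaginary part `Y` of `Z = X + iY`. -/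
def imPart {n : ℕ} (Z : SiegelSpace n) : Matrix (Fin n) (Fin n) ℝ :=
  (Z : Matrix (Fin n) (Fin n) ℂ).map Complex.im

theorem imPart_posDef {n : ℕ} (Z : SiegelSpace n) : (imPart Z).PosDef := Z.2.2

/-- The block `A` of `g = (A B; C D)`, as a complex matrix. -/
def blockA {n : ℕ} (g : symplecticGroup (Fin n) ℝ) : Matrix (Fin n) (Fin n) ℂ :=
  (g : Matrix (Fin n ⊕ Fin n) (Fin n ⊕ Fin n) ℝ).toBlocks₁₁.map (↑)

/-- The block `B` of `g = (A B; C D)`, as a complex matrix. -/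
def blockB {n : ℕ} (g : symplecticGroup (Fin n) ℝ) : Matrix (Fin n) (Fin n) ℂ :=
  (g : Matrix (Fin n ⊕ Fin n) (Fin n ⊕ Fin n) ℝ).toBlocks₁₂.map (↑)

/-- The block `C` of `g = (A B; C D)`, as a complex matrix. -/
def blockC {n : ℕ} (g : symplecticGroup (Fin n) ℝ) : Matrix (Fin n) (Fin n) ℂ :=
  (g : Matrix (Fin n ⊕ Fin n) (Fin n ⊕ Fin n) ℝ).toBlocks₂₁.map (↑)

/-- The block `D` of `g = (A B; C D)`, as a complex matrix. -/
def blockD {n : ℕ} (g : symplecticGroup (Fin n) ℝ) : Matrix (Fin n) (Fin n) ℂ :=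
  (g : Matrix (Fin n ⊕ Fin n) (Fin n ⊕ Fin n) ℝ).toBlocks₂₂.map (↑)

theorem block_relations {n : ℕ} (g : symplecticGroup (Fin n) ℝ) :
    (blockA g)ᵀ * blockC g = (blockC g)ᵀ * blockA g ∧
    (blockB g)ᵀ * blockD g = (blockD g)ᵀ * blockB g ∧
    (blockA g)ᵀ * blockD g - (blockC g)ᵀ * blockB g = 1 ∧
    (blockD g)ᵀ * blockA g - (blockB g)ᵀ * blockC g = 1 := by
  have h := SymplecticGroup.map_mem g.2 Complex.ofRealHom
  rw [← Matrix.fromBlocks_toBlocks (Matrix.map _ _), SymplecticGroup.fromBlocks_mem_iff] at h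
  obtain ⟨h1, h2, h3⟩ := h
  refine ⟨h1, h2, h3, ?_⟩
  have h4 := congrArg Matrix.transpose h3
  rw [Matrix.transpose_sub, Matrix.transpose_mul, Matrix.transpose_mul, Matrix.transpose_transpose,
    Matrix.transpose_transpose, Matrix.transpose_one] at h4
  exact h4

theorem block_conjTranspose {n : ℕ} (g : symplecticGroup (Fin n) ℝ) :
    (blockA g)ᴴ = (blockA g)ᵀ ∧ (blockB g)ᴴ = (blockB g)ᵀ ∧
    (blockC g)ᴴ = (blockC g)ᵀ ∧ (blockD g)ᴴ = (blockD g)ᵀ := by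
  refine ⟨?_, ?_, ?_, ?_⟩ <;> ext i j <;>
    simp [blockA, blockB, blockC, blockD, Matrix.conjTranspose_apply]

/-- The matrix `CZ + D`. -/
def denomMatrix {n : ℕ} (g : symplecticGroup (Fin n) ℝ) (Z : SiegelSpace n) :
    Matrix (Fin n) (Fin n) ℂ := blockC g * Z + blockD g

/-- The matrix `AZ + B`. -/
def numMatrix {n : ℕ} (g : symplecticGroup (Fin n) ℝ) (Z : SiegelSpace n) :
    Matrix (Fin n) (Fin n) ℂ := blockA g * Z + blockB g

theorem sub_conjTranspose_eq {n : ℕ} {Z : Matrix (Fin n) (Fin n) ℂ} (hZ : Zᵀ = Z) :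
    Z - Zᴴ = (2 * Complex.I) • (Z.map Complex.im).map ((↑) : ℝ → ℂ) := by
  ext i j
  have h : Z j i = Z i j := congrFun (congrFun hZ i) j
  simp only [Matrix.sub_apply, Matrix.conjTranspose_apply, h, Matrix.smul_apply, Matrix.map_apply,
    smul_eq_mul]
  apply Complex.ext <;> simp
  ring

theorem denom_num_transpose {n : ℕ} (g : symplecticGroup (Fin n) ℝ) (Z : SiegelSpace n) :
    (denomMatrix g Z)ᵀ * numMatrix g Z = (numMatrix g Z)ᵀ * denomMatrix g Z := by
  obtain ⟨h1, h2, h3, h4⟩ := block_relations g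
  have hZ := Z.2.1
  rw [← sub_eq_zero]
  simp only [denomMatrix, numMatrix, Matrix.transpose_add, Matrix.transpose_mul, hZ]
  have e : ∀ (W A B C D A' B' C' D' : Matrix (Fin n) (Fin n) ℂ),
      (W * C' + D') * (A * W + B) - (W * A' + B') * (C * W + D)
      = W * (C' * A - A' * C) * W - W * (A' * D - C' * B) + (D' * A - B' * C) * W
        + (D' * B - B' * D) := by
    intros; noncomm_ring
  rw [e, h1, h2, h3, h4]
  simp

theorem denom_num_conjTranspose {n : ℕ} (g : symplecticGroup (Fin n) ℝ) (Z : SiegelSpace n) :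
    (denomMatrix g Z)ᴴ * numMatrix g Z - (numMatrix g Z)ᴴ * denomMatrix g Z
      = (Z : Matrix (Fin n) (Fin n) ℂ) - (Z : Matrix (Fin n) (Fin n) ℂ)ᴴ := by
  obtain ⟨h1, h2, h3, h4⟩ := block_relations g
  obtain ⟨k1, k2, k3, k4⟩ := block_conjTranspose g
  simp only [denomMatrix, numMatrix, Matrix.conjTranspose_add, Matrix.conjTranspose_mul,
    k1, k2, k3, k4]
  have e : ∀ (W V A B C D A' B' C' D' : Matrix (Fin n) (Fin n) ℂ),
      (V * C' + D') * (A * W + B) - (V * A' + B') * (C * W + D)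
      = V * (C' * A - A' * C) * W - V * (A' * D - C' * B) + (D' * A - B' * C) * W
        + (D' * B - B' * D) := by
    intros; noncomm_ring
  rw [e, h1, h2, h3, h4]
  simp
  abel

theorem isUnit_denomMatrix {n : ℕ} (g : symplecticGroup (Fin n) ℝ) (Z : SiegelSpace n) :
    IsUnit (denomMatrix g Z) := by
  open scoped ComplexOrder in
  rw [← Matrix.mulVec_injective_iff_isUnit]
  rw [← Matrix.coe_mulVecLin, injective_iff_map_eq_zero]
  intro v hv
  by_contra hv0
  have hv' : denomMatrix g Z *ᵥ v = 0 := hv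
  have hpos := (posDef_map_ofReal_iff.2 (imPart_posDef Z)).dotProduct_mulVec_pos hv0
  have key := congrArg (fun M => star v ⬝ᵥ (M *ᵥ v)) (denom_num_conjTranspose g Z)
  simp only [sub_conjTranspose_eq Z.2.1, Matrix.sub_mulVec, ← Matrix.mulVec_mulVec, hv',
    Matrix.mulVec_zero, sub_zero, Matrix.smul_mulVec, dotProduct_smul] at key
  rw [Matrix.dotProduct_mulVec, ← Matrix.star_mulVec, hv', star_zero, zero_dotProduct] at key
  have := (smul_eq_zero.1 key.symm).resolve_left (by simp)
  exact hpos.ne' this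

/-- The factor of automorphy `J(g, Z) = CZ + D`, an element of `GL_n(ℂ)`. -/
noncomputable def autFactor {n : ℕ} (g : symplecticGroup (Fin n) ℝ) (Z : SiegelSpace n) :
    GL (Fin n) ℂ := (isUnit_denomMatrix g Z).unit

theorem moebius_mem {n : ℕ} (g : symplecticGroup (Fin n) ℝ) (Z : SiegelSpace n) :
    numMatrix g Z * (denomMatrix g Z)⁻¹ ∈ siegelSet n := by
  open scoped ComplexOrder in
  have hu := isUnit_denomMatrix g Z
  have hd := (Matrix.isUnit_iff_isUnit_det _).1 hu
  have hdT : IsUnit (denomMatrix g Z)ᵀ.det := by rwa [Matrix.det_transpose]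
  have hdH : IsUnit (denomMatrix g Z)ᴴ.det := by rw [Matrix.det_conjTranspose]; exact hd.star
  have hsym : (numMatrix g Z * (denomMatrix g Z)⁻¹)ᵀ = numMatrix g Z * (denomMatrix g Z)⁻¹ := by
    rw [Matrix.transpose_mul, Matrix.transpose_nonsing_inv]
    have h := denom_num_transpose g Z
    calc (denomMatrix g Z)ᵀ⁻¹ * (numMatrix g Z)ᵀ
        = (denomMatrix g Z)ᵀ⁻¹ * ((numMatrix g Z)ᵀ * denomMatrix g Z) * (denomMatrix g Z)⁻¹ := by
          rw [Matrix.mul_assoc, Matrix.mul_assoc, Matrix.mul_nonsing_inv _ hd, Matrix.mul_one]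
      _ = numMatrix g Z * (denomMatrix g Z)⁻¹ := by
          rw [← h, ← Matrix.mul_assoc, Matrix.nonsing_inv_mul _ hdT, Matrix.one_mul]
  refine ⟨hsym, posDef_map_ofReal_iff.1 ?_⟩
  have h2I : (2 * Complex.I) ≠ 0 := by simp
  have e : ((numMatrix g Z * (denomMatrix g Z)⁻¹).map Complex.im).map ((↑) : ℝ → ℂ)
      = ((denomMatrix g Z)⁻¹)ᴴ * (imPart Z).map ((↑) : ℝ → ℂ) * (denomMatrix g Z)⁻¹ := by
    apply smul_right_injective _ h2I
    simp only
    rw [← sub_conjTranspose_eq hsym, ← Matrix.smul_mul, ← Matrix.mul_smul]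
    rw [show (2 * Complex.I) • (imPart Z).map ((↑) : ℝ → ℂ) = _ from
      (sub_conjTranspose_eq Z.2.1).symm, ← denom_num_conjTranspose g Z]
    rw [Matrix.conjTranspose_mul, Matrix.conjTranspose_nonsing_inv, Matrix.mul_sub, Matrix.sub_mul,
      ← Matrix.mul_assoc, Matrix.nonsing_inv_mul _ hdH, Matrix.one_mul,
      Matrix.mul_assoc, Matrix.mul_assoc, Matrix.mul_nonsing_inv _ hd, Matrix.mul_one]
  rw [e]
  exact (posDef_map_ofReal_iff.2 (imPart_posDef Z)).conjTranspose_mul_mul_same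
    (Matrix.mulVec_injective_iff_isUnit.2
      ((Matrix.isUnit_iff_isUnit_det _).2 (by simpa using hd)))

/-- The action `gZ = (AZ + B)(CZ + D)⁻¹` of `Sp_{2n}(ℝ)` on `ℍ_n`. -/
noncomputable def moebius {n : ℕ} (g : symplecticGroup (Fin n) ℝ) (Z : SiegelSpace n) :
    SiegelSpace n := ⟨numMatrix g Z * (denomMatrix g Z)⁻¹, moebius_mem g Z⟩

/-! ### Nearly holomorphic functions and Fourier expansions -/

/-- The index set `{(i, j) : i ≤ j}`. -/
abbrev UpperIndex (n : ℕ) : Type := {q : Fin n × Fin n // q.1 ≤ q.2}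

/-- The exponents `(b_{ij})_{i ≤ j}` of nonnegative integers with `∑ b_{ij} ≤ p`. -/
def exponents (n p : ℕ) : Finset (UpperIndex n → ℕ) :=
  (Fintype.piFinset fun _ => Finset.range (p + 1)).filter fun b => ∑ q, b q ≤ p

theorem mem_exponents {n p : ℕ} {b : UpperIndex n → ℕ} :
    b ∈ exponents n p ↔ ∑ q, b q ≤ p := by
  simp only [exponents, Finset.mem_filter, Fintype.mem_piFinset, Finset.mem_range,
    and_iff_right_iff_imp]
  intro h q
  exact Nat.lt_succ_of_le ((Finset.single_le_sum (fun _ _ => Nat.zero_le _)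
    (Finset.mem_univ q)).trans h)

/-- The monomial `[V]^b = ∏_{i ≤ j} v_{ij}^{b_{ij}}`. -/
def entryMonomial {n : ℕ} (V : Matrix (Fin n) (Fin n) ℝ) (b : UpperIndex n → ℕ) : ℝ :=
  ∏ q : UpperIndex n, V q.1.1 q.1.2 ^ b q

/-- `f ∈ N^p(ℍ_n)`: `f` is a polynomial of total degree at most `p` in the entries of `Y⁻¹`, with
holomorphic functions on `ℍ_n` as coefficients. Holomorphy on `ℍ_n`, which is open in the space of
symmetric complex matrices, is complex differentiability along the set `ℍ_n`. -/
def IsNearlyHolomorphic {n : ℕ} (p : ℕ) (f : SiegelSpace n → ℂ) : Prop :=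
  ∃ G : (UpperIndex n → ℕ) → Matrix (Fin n) (Fin n) ℂ → ℂ,
    (∀ b, DifferentiableOn ℂ (G b) (siegelSet n)) ∧
    ∀ Z : SiegelSpace n,
      f Z = ∑ b ∈ exponents n p, G b Z * (entryMonomial (imPart Z)⁻¹ b : ℂ)

/-- The positive semidefinite matrices in `(1/N) M_n^sym(ℤ)`. -/
def fourierIndex (n N : ℕ) : Set (Matrix (Fin n) (Fin n) ℝ) :=
  {S | (∃ T : Matrix (Fin n) (Fin n) ℤ, Tᵀ = T ∧ S = (1 / (N : ℝ)) • T.map ((↑) : ℤ → ℝ)) ∧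
    S.PosSemidef}

/-- The function `e^{2πi Tr(SZ)}`. -/
noncomputable def fourierExp {n : ℕ} (S : Matrix (Fin n) (Fin n) ℝ) (Z : SiegelSpace n) : ℂ :=
  Complex.exp (2 * Real.pi * Complex.I *
    (S.map ((↑) : ℝ → ℂ) * (Z : Matrix (Fin n) (Fin n) ℂ)).trace)

/-- A function in `N^p(ℍ_n)` has a nice Fourier expansion if, for some positive integer `N`,
`f(Z) = ∑_b ∑_S a_b(S) e^{2πi Tr(SZ)} [Y⁻¹]^b`, with `S` running over the positive semidefinite
matrices in `(1/N) M_n^sym(ℤ)` and absolute and uniform convergence on compact subsets. -/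
def HasNiceFourierExpansion {n : ℕ} (p : ℕ) (f : SiegelSpace n → ℂ) : Prop :=
  ∃ N : ℕ, 0 < N ∧ ∃ a : (UpperIndex n → ℕ) → Matrix (Fin n) (Fin n) ℝ → ℂ,
    let term : (exponents n p × fourierIndex n N) → SiegelSpace n → ℂ := fun q Z =>
      a q.1 q.2 * fourierExp (q.2 : Matrix (Fin n) (Fin n) ℝ) Z *
        (entryMonomial (imPart Z)⁻¹ (q.1 : UpperIndex n → ℕ) : ℂ)
    (∀ Z, Summable fun q => ‖term q Z‖) ∧
    ∀ K : Set (SiegelSpace n), IsCompact K → HasSumUniformlyOn term f K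

/-! ### Congruence subgroups -/

/-- The homomorphism of symplectic groups induced by a ring homomorphism. -/
def symplecticMap (n : ℕ) {R S : Type*} [CommRing R] [CommRing S] (φ : R →+* S) :
    symplecticGroup (Fin n) R →* symplecticGroup (Fin n) S where
  toFun g := ⟨(g : Matrix (Fin n ⊕ Fin n) (Fin n ⊕ Fin n) R).map φ,
    SymplecticGroup.map_mem g.2 φ⟩
  map_one' := Subtype.ext (by simp)
  map_mul' g h := Subtype.ext (by simp)

/-- `Sp_{2n}(ℤ)` as a subgroup of `Sp_{2n}(ℚ)`. -/
def integralSymplectic (n : ℕ) : Subgroup (symplecticGroup (Fin n) ℚ) :=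
  (symplecticMap n (Int.castRingHom ℚ)).range

/-- The principal congruence subgroup of level `N`, the kernel of reduction modulo `N` on
`Sp_{2n}(ℤ)`, as a subgroup of `Sp_{2n}(ℚ)`. -/
def principalCongruence (n N : ℕ) : Subgroup (symplecticGroup (Fin n) ℚ) :=
  (symplecticMap n (Int.castRingHom (ZMod N))).ker.map (symplecticMap n (Int.castRingHom ℚ))

/-- Congruence subgroups of `Sp_{2n}(ℚ)`. -/
def IsCongruenceSubgroup {n : ℕ} (Γ : Subgroup (symplecticGroup (Fin n) ℚ)) : Prop :=
  Γ.Commensurable (integralSymplectic n) ∧ ∃ N : ℕ, 0 < N ∧ principalCongruence n N ≤ Γ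

/-! ### Rational representations of `GL_n(ℂ)` -/

section Rep

variable {n : ℕ} {V : Type*} [AddCommGroup V] [Module ℂ V]

/-- A representation of `GL_n(ℂ)` is rational if its matrix coefficients are regular functions on
`GL_n(ℂ)`, i.e. polynomials in the matrix entries divided by powers of the determinant. -/
def IsRational (ρ : Representation ℂ (GL (Fin n) ℂ) V) : Prop :=
  ∀ (v : V) (l : Module.Dual ℂ V), ∃ (P : MvPolynomial (Fin n × Fin n) ℂ) (k : ℕ),
    ∀ g : GL (Fin n) ℂ,
      l (ρ g v) = MvPolynomial.eval (fun q => (g : Matrix (Fin n) (Fin n) ℂ) q.1 q.2) P /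
        (g : Matrix (Fin n) (Fin n) ℂ).det ^ k

/-- `lam` is the highest weight of `ρ`: some nonzero vector is an eigenvector of the group of
upper triangular matrices, with character `b ↦ ∏_i b_{ii}^{lam_i}`. -/
def IsHighestWeight (ρ : Representation ℂ (GL (Fin n) ℂ) V) (lam : Fin n → ℤ) : Prop :=
  ∃ v : V, v ≠ 0 ∧ ∀ g : GL (Fin n) ℂ, (g : Matrix (Fin n) (Fin n) ℂ).BlockTriangular id →
    ρ g v = (∏ i, (g : Matrix (Fin n) (Fin n) ℂ) i i ^ lam i) • v

/-- The slash operator `(F|_ρ g)(Z) = ρ(J(g, Z))⁻¹ F(gZ)`. -/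
noncomputable def slash (ρ : Representation ℂ (GL (Fin n) ℂ) V) (F : SiegelSpace n → V)
    (g : symplecticGroup (Fin n) ℝ) (Z : SiegelSpace n) : V :=
  ρ (autFactor g Z)⁻¹ (F (moebius g Z))

/-- `Sp_{2n}(ℚ)` inside `Sp_{2n}(ℝ)`. -/
noncomputable def ratToReal (n : ℕ) : symplecticGroup (Fin n) ℚ →* symplecticGroup (Fin n) ℝ :=
  symplecticMap n (Rat.castHom ℝ)

/-- The space `N^p_ρ(Γ)`. -/
structure IsNearlyHolomorphicForm (ρ : Representation ℂ (GL (Fin n) ℂ) V) (p : ℕ)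
    (Γ : Subgroup (symplecticGroup (Fin n) ℚ)) (F : SiegelSpace n → V) : Prop where
  nearlyHolomorphic : ∀ (g : symplecticGroup (Fin n) ℚ) (l : Module.Dual ℂ V),
    IsNearlyHolomorphic p fun Z => l (slash ρ F (ratToReal n g) Z)
  fourier : ∀ (g : symplecticGroup (Fin n) ℚ) (l : Module.Dual ℂ V),
    HasNiceFourierExpansion p fun Z => l (slash ρ F (ratToReal n g) Z)
  invariant : ∀ γ ∈ Γ, slash ρ F (ratToReal n γ) = F

/-- The space `N_ρ^{(n)}` of nearly holomorphic Siegel modular forms of weight `ρ`, with respect to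
some congruence subgroup. -/
def nearlyHolomorphicForms (ρ : Representation ℂ (GL (Fin n) ℂ) V) : Set (SiegelSpace n → V) :=
  {F | ∃ Γ : Subgroup (symplecticGroup (Fin n) ℚ), IsCongruenceSubgroup Γ ∧
    ∃ p : ℕ, IsNearlyHolomorphicForm ρ p Γ F}

end Rep

end SiegelModular

/-! For γ in Sp_{2n}(ℤ) put h = Y^{1/2} J(γ, Z)⁻¹. From F = (F|γ⁻¹)|γ one gets ρ(Y^{1/2}) F(Z) =
ρ(h) (F|γ⁻¹)(γZ). Moreover Im(γZ) = h*h, so Tr(Im(γZ)⁻¹) is the sum of the squared absolute values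
of the entries of h⁻¹ = (CZ+D) Y^{-1/2}. The proof chooses γ so that this trace is bounded in terms
of n alone, and then bounds the two factors separately.

Choice of γ (`exists_reduced_point`). The rows of Y^{-1/2} and Z Y^{-1/2} are a symplectic frame of
ℂⁿ for the imaginary part of the hermitian product. Integral symplectic matrices change frames
inside the lattice they span, and the rows of (CZ+D) Y^{-1/2} are half of the new frame. A frame
with that half short is built by induction on n (`exists_bounded_frame`): take an almost shortest
possible first vector, project away from it, reduce the projected frame and lift it back.

The vector (F|γ⁻¹)(γZ). By invariance only finitely many functions F|γ⁻¹ occur. On the region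
Tr(Y⁻¹) ≤ C the Fourier series of each is dominated term by term by the series at one fixed point,
where it converges absolutely (`exists_uniform_bound`).

The operator ρ(h). Write hg = kb with k unitary and b upper triangular. A highest weight vector is
scaled by b through its diagonal, whose inverses are bounded, so all exponents can be raised to λ₁
at the cost of a constant. This gives ‖ρ(h)‖ ≤ C |det h|^{λ₁} (`exists_norm_le_det_zpow`).

If λ₁ ≤ 0, boundedness of det h⁻¹ is enough. If λ₁ ≥ 0, a lower bound |det(CZ+D)| ≥ c ∏ min(μ_i, 1)
is needed (`prod_min_le_norm_det_denomMatrix`). It comes from the fact that det(CZ+D) has no zeros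
on ℍ_n and is a nonzero Gaussian integer at Z = i. -/

namespace SiegelModular

/-! ### Reduction of symplectic frames -/

section Frames

variable {E : Type*} [NormedAddCommGroup E] [InnerProductSpace ℂ E]

/-- The symplectic form given by the imaginary part of a hermitian inner product. -/
noncomputable def imInner (x y : E) : ℝ := (inner ℂ x y).im

theorem imInner_add_left (x y z : E) : imInner (x + y) z = imInner x z + imInner y z := by
  simp [imInner]

theorem imInner_add_right (x y z : E) : imInner x (y + z) = imInner x y + imInner x z := by
  simp [imInner]

theorem imInner_zsmul_left (k : ℤ) (x y : E) : imInner (k • x) y = k * imInner x y := by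
  rw [imInner, ← Int.cast_smul_eq_zsmul ℂ, inner_smul_left]
  simp [imInner]

theorem imInner_zsmul_right (k : ℤ) (x y : E) : imInner x (k • y) = k * imInner x y := by
  rw [imInner, ← Int.cast_smul_eq_zsmul ℂ, inner_smul_right]
  simp [imInner]

theorem imInner_neg_right (x y : E) : imInner x (-y) = -imInner x y := by
  simp [imInner]

theorem imInner_zero_left (y : E) : imInner 0 y = 0 := by simp [imInner]

theorem imInner_zero_right (y : E) : imInner y 0 = 0 := by simp [imInner]

theorem imInner_self (x : E) : imInner x x = 0 := by
  have := inner_self_im (𝕜 := ℂ) x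
  simpa [imInner] using this

theorem imInner_swap (x y : E) : imInner x y = -imInner y x := by
  rw [imInner, imInner, ← inner_conj_symm, Complex.conj_im]

theorem imInner_sum_left {ι : Type*} (s : Finset ι) (f : ι → E) (y : E) :
    imInner (∑ i ∈ s, f i) y = ∑ i ∈ s, imInner (f i) y := by
  simp [imInner]

theorem imInner_sum_right {ι : Type*} (s : Finset ι) (f : ι → E) (y : E) :
    imInner y (∑ i ∈ s, f i) = ∑ i ∈ s, imInner y (f i) := by
  simp [imInner]

/-- Two families of vectors that pair like a symplectic basis. -/
structure IsSymplecticFrame {ι : Type*} [DecidableEq ι] (e f : ι → E) : Prop where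
  left : ∀ i j, imInner (e i) (e j) = 0
  right : ∀ i j, imInner (f i) (f j) = 0
  pair : ∀ i j, imInner (e i) (f j) = if i = j then 1 else 0

/-- The lattice spanned by a frame. -/
def frameLattice {ι : Type*} (e f : ι → E) : Submodule ℤ E :=
  Submodule.span ℤ (Set.range e ∪ Set.range f)

omit [InnerProductSpace ℂ E] in
theorem left_mem_frameLattice {ι : Type*} (e f : ι → E) (i : ι) : e i ∈ frameLattice e f :=
  Submodule.subset_span (Or.inl ⟨i, rfl⟩)

omit [InnerProductSpace ℂ E] in
theorem right_mem_frameLattice {ι : Type*} (e f : ι → E) (i : ι) : f i ∈ frameLattice e f :=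
  Submodule.subset_span (Or.inr ⟨i, rfl⟩)

omit [InnerProductSpace ℂ E] in
theorem frameLattice_le {ι κ : Type*} {e f : ι → E} {e' f' : κ → E}
    (he : ∀ i, e' i ∈ frameLattice e f) (hf : ∀ i, f' i ∈ frameLattice e f) :
    frameLattice e' f' ≤ frameLattice e f := by
  refine Submodule.span_le.2 ?_
  rintro _ (⟨i, rfl⟩ | ⟨i, rfl⟩)
  exacts [he i, hf i]

theorem imInner_eq_zero_of_mem_frameLattice {ι : Type*} {e f : ι → E} {x y : E}
    (he : ∀ i, imInner x (e i) = 0) (hf : ∀ i, imInner x (f i) = 0)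
    (hy : y ∈ frameLattice e f) : imInner x y = 0 := by
  induction hy using Submodule.span_induction with
  | mem y hy => rcases hy with ⟨i, rfl⟩ | ⟨i, rfl⟩; exacts [he i, hf i]
  | zero => exact imInner_zero_right x
  | add a b _ _ ha hb => rw [imInner_add_right, ha, hb, add_zero]
  | smul k a _ ha => rw [imInner_zsmul_right, ha, mul_zero]

/-- Among the frames of a lattice one with almost shortest first vector can be chosen, unless
there is one whose first vector has length at most one. -/
theorem exists_almost_minimal_frame {n : ℕ} (e f : Fin (n + 1) → E) (h : IsSymplecticFrame e f) :
    ∃ a b : Fin (n + 1) → E, IsSymplecticFrame a b ∧ (∀ i, a i ∈ frameLattice e f) ∧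
      (∀ i, b i ∈ frameLattice e f) ∧ (‖a 0‖ ^ 2 ≤ 1 ∨ ∀ a' b' : Fin (n + 1) → E,
        IsSymplecticFrame a' b' → (∀ i, a' i ∈ frameLattice e f) →
          (∀ i, b' i ∈ frameLattice e f) → 7 / 8 * ‖a 0‖ ^ 2 ≤ ‖a' 0‖ ^ 2) := by
  set S : Set ℝ := {r | ∃ a b : Fin (n + 1) → E, IsSymplecticFrame a b ∧
    (∀ i, a i ∈ frameLattice e f) ∧ (∀ i, b i ∈ frameLattice e f) ∧ r = ‖a 0‖ ^ 2} with hS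
  have hne : S.Nonempty := ⟨_, e, f, h, left_mem_frameLattice e f, right_mem_frameLattice e f, rfl⟩
  by_cases h1 : ∃ r ∈ S, r ≤ 1
  · obtain ⟨_, ⟨a, b, hab, ha, hb, rfl⟩, hr⟩ := h1
    exact ⟨a, b, hab, ha, hb, Or.inl hr⟩
  · push Not at h1
    have hbdd : BddBelow S := ⟨1, fun r hr => (h1 r hr).le⟩
    have hm : 1 ≤ sInf S := le_csInf hne fun r hr => (h1 r hr).le
    -- Attainment of the infimum is not needed. Since it is at least 1, the number 8/7 times it is
    -- strictly larger and is undercut by some frame.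
    obtain ⟨_, ⟨a, b, hab, ha, hb, rfl⟩, hr⟩ := exists_lt_of_csInf_lt hne
      (show sInf S < 8 / 7 * sInf S by linarith)
    refine ⟨a, b, hab, ha, hb, Or.inr fun a' b' hab' ha' hb' => ?_⟩
    have := csInf_le hbdd (show ‖a' 0‖ ^ 2 ∈ S from ⟨a', b', hab', ha', hb', rfl⟩)
    linarith

/-- The orthogonal projection onto the complement of a vector. -/
noncomputable abbrev projPerp (v : E) : E →L[ℂ] (Submodule.span ℂ {v})ᗮ :=
  (Submodule.span ℂ {v})ᗮ.orthogonalProjectionOnto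

theorem inner_eq_inner_projPerp (v x y : E) :
    inner ℂ x y = inner ℂ (projPerp v x) (projPerp v y) +
      (starRingEnd ℂ) (inner ℂ v x) * inner ℂ v y / ((‖v‖ ^ 2 : ℝ) : ℂ) := by
  have hx := Submodule.starProjection_add_starProjection_orthogonal (K := Submodule.span ℂ {v}) x
  have h1 : inner ℂ (projPerp v x) (projPerp v y)
      = inner ℂ ((Submodule.span ℂ {v})ᗮ.starProjection x) y := by
    rw [Submodule.inner_orthogonalProjectionOnto_eq_of_mem_left]
    rfl
  have h2 := congrArg (fun z => inner ℂ z y) hx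
  simp only [inner_add_left, Submodule.starProjection_singleton, inner_smul_left] at h2
  rw [← h2, h1]
  simp only [map_div₀, Complex.conj_ofReal, RCLike.ofReal_eq_complex_ofReal]
  ring

/-- Both inner products with `v` are real, so the component along `v` contributes a real number to
the inner product. Thus the symplectic quotient by `v` is realised in the hermitian complement of
the complex line of `v`. -/
theorem imInner_eq_imInner_projPerp {v x y : E} (hx : imInner v x = 0) (hy : imInner v y = 0) :
    imInner x y = imInner (projPerp v x) (projPerp v y) := by
  rw [imInner, inner_eq_inner_projPerp v x y, Complex.add_im, imInner, Complex.div_ofReal_im,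
    Complex.mul_im, Complex.conj_im, show (inner ℂ v x).im = 0 from hx,
    show (inner ℂ v y).im = 0 from hy]
  simp

theorem norm_sq_eq_projPerp (v x : E) :
    ‖x‖ ^ 2 = ‖projPerp v x‖ ^ 2 + Complex.normSq (inner ℂ v x) / ‖v‖ ^ 2 := by
  have h := congrArg Complex.re (inner_eq_inner_projPerp v x x)
  rw [Complex.add_re, Complex.div_ofReal_re, ← Complex.normSq_eq_conj_mul_self,
    Complex.ofReal_re] at h
  have e1 := norm_sq_eq_re_inner (𝕜 := ℂ) x
  have e2 := norm_sq_eq_re_inner (𝕜 := ℂ) (projPerp v x)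
  simp only [RCLike.re_eq_complex_re] at e1 e2
  rw [e1, e2, h]

theorem projPerp_self (v : E) : projPerp v v = 0 := by
  rw [Submodule.orthogonalProjectionOnto_eq_zero_iff]
  exact Submodule.le_orthogonal_orthogonal _ (Submodule.mem_span_singleton_self v)

/-- A multiple of `v` can be added to `x` so that the component along `v` becomes short. -/
theorem exists_zsmul_norm_sq_le {v : E} (hv : v ≠ 0) (x : E) : ∃ k : ℤ,
    ‖x + k • v‖ ^ 2 ≤ ‖projPerp v x‖ ^ 2 + ‖v‖ ^ 2 / 4 + imInner v x ^ 2 / ‖v‖ ^ 2 := by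
  have hv' : 0 < ‖v‖ ^ 2 := by positivity
  -- Integer multiples of `v` move only the real part of the inner product with `v`. Rounding brings
  -- it down to at most `‖v‖ ^ 2 / 2`, which contributes `‖v‖ ^ 2 / 4`; the imaginary part is the
  -- last term of the bound.
  set r := (inner ℂ v x).re / ‖v‖ ^ 2 with hr
  refine ⟨-round r, ?_⟩
  have hi : inner ℂ v (x + (-round r) • v)
      = inner ℂ v x - ((round r * ‖v‖ ^ 2 : ℝ) : ℂ) := by
    rw [inner_add_right, ← Int.cast_smul_eq_zsmul ℂ, inner_smul_right, inner_self_eq_norm_sq_to_K]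
    push_cast
    simp
    ring
  have hp : projPerp v (x + (-round r) • v) = projPerp v x := by
    rw [map_add, ← Int.cast_smul_eq_zsmul ℂ, map_smul, projPerp_self, smul_zero, add_zero]
  rw [norm_sq_eq_projPerp v, hp, hi, add_assoc]
  gcongr
  have h1 : (inner ℂ v x).re = r * ‖v‖ ^ 2 := by rw [hr]; field_simp
  have h3 : (r - round r) ^ 2 ≤ 1 / 4 := by
    have h2 := abs_sub_round r
    rw [← sq_abs]; nlinarith [abs_nonneg (r - round r)]
  rw [Complex.normSq_apply, Complex.sub_re, Complex.sub_im, Complex.ofReal_re, Complex.ofReal_im,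
    sub_zero, add_div, imInner, ← sq, ← sq, h1, ← sub_mul, mul_pow]
  refine add_le_add_left ?_ _
  rw [div_le_iff₀ hv']
  nlinarith [sq_nonneg (‖v‖ ^ 2)]

end Frames

section Frames

variable {E : Type*} [NormedAddCommGroup E] [InnerProductSpace ℂ E]

theorem IsSymplecticFrame.comp {ι κ : Type*} [DecidableEq ι] [DecidableEq κ] {e f : ι → E}
    (h : IsSymplecticFrame e f) {s : κ → ι} (hs : Function.Injective s) :
    IsSymplecticFrame (e ∘ s) (f ∘ s) where
  left i j := h.left _ _
  right i j := h.right _ _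
  pair i j := by simp [h.pair, hs.eq_iff]

theorem IsSymplecticFrame.ne_zero {ι : Type*} [DecidableEq ι] {e f : ι → E}
    (h : IsSymplecticFrame e f) (i : ι) : e i ≠ 0 := by
  intro h0
  have := h.pair i i
  rw [h0, imInner_zero_left] at this
  simp at this

/-- Projecting the remaining vectors of a frame away from its first vector gives a frame. -/
theorem IsSymplecticFrame.projPerp {n : ℕ} {e f : Fin (n + 1) → E} (h : IsSymplecticFrame e f) :
    IsSymplecticFrame (fun i : Fin n => projPerp (e 0) (e i.succ))
      (fun i : Fin n => projPerp (e 0) (f i.succ)) := by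
  have he : ∀ i : Fin n, imInner (e 0) (e i.succ) = 0 := fun i => h.left _ _
  have hf : ∀ i : Fin n, imInner (e 0) (f i.succ) = 0 := fun i => by
    rw [h.pair, if_neg (Fin.succ_ne_zero i).symm]
  refine ⟨fun i j => ?_, fun i j => ?_, fun i j => ?_⟩
  · rw [← imInner_eq_imInner_projPerp (he i) (he j), h.left]
  · rw [← imInner_eq_imInner_projPerp (hf i) (hf j), h.right]
  · rw [← imInner_eq_imInner_projPerp (he i) (hf j), h.pair]
    simp

theorem exists_lift_of_mem_frameLattice {n : ℕ} {e f : Fin (n + 1) → E}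
    {x : (Submodule.span ℂ {e 0})ᗮ}
    (hx : x ∈ frameLattice (fun i : Fin n => projPerp (e 0) (e i.succ))
      (fun i : Fin n => projPerp (e 0) (f i.succ))) :
    ∃ y ∈ frameLattice (fun i : Fin n => e i.succ) (fun i : Fin n => f i.succ),
      projPerp (e 0) y = x := by
  have : x ∈ (frameLattice (fun i : Fin n => e i.succ) (fun i : Fin n => f i.succ)).map
      ((projPerp (e 0)).toLinearMap.restrictScalars ℤ) := by
    rw [frameLattice, Submodule.map_span, Set.image_union, ← Set.range_comp, ← Set.range_comp]
    exact hx
  obtain ⟨y, hy, rfl⟩ := this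
  exact ⟨y, hy, rfl⟩

/-- A frame of the complement of the first vector lifts to a frame of the whole space, whose
vectors are longer only by a fraction of the length of the first vector. -/
theorem IsSymplecticFrame.exists_lift {n : ℕ} {e f : Fin (n + 1) → E} (h : IsSymplecticFrame e f)
    {x y : Fin n → (Submodule.span ℂ {e 0})ᗮ} (hxy : IsSymplecticFrame x y)
    (hx : ∀ i, x i ∈ frameLattice (fun i : Fin n => SiegelModular.projPerp (e 0) (e i.succ))
      (fun i : Fin n => SiegelModular.projPerp (e 0) (f i.succ)))
    (hy : ∀ i, y i ∈ frameLattice (fun i : Fin n => SiegelModular.projPerp (e 0) (e i.succ))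
      (fun i : Fin n => SiegelModular.projPerp (e 0) (f i.succ))) :
    ∃ a b : Fin (n + 1) → E, IsSymplecticFrame a b ∧ (∀ i, a i ∈ frameLattice e f) ∧
      (∀ i, b i ∈ frameLattice e f) ∧ a 0 = e 0 ∧
      ∀ i : Fin n, ‖a i.succ‖ ^ 2 ≤ ‖x i‖ ^ 2 + ‖e 0‖ ^ 2 / 4 := by
  choose u hu hux using fun i => exists_lift_of_mem_frameLattice (hx i)
  choose v hv hvy using fun i => exists_lift_of_mem_frameLattice (hy i)
  have perp_e : ∀ z ∈ frameLattice (fun i : Fin n => e i.succ) (fun i : Fin n => f i.succ),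
      imInner (e 0) z = 0 := fun z hz => imInner_eq_zero_of_mem_frameLattice
    (fun i => h.left _ _) (fun i => by rw [h.pair, if_neg (Fin.succ_ne_zero i).symm]) hz
  have perp_f : ∀ z ∈ frameLattice (fun i : Fin n => e i.succ) (fun i : Fin n => f i.succ),
      imInner (f 0) z = 0 := fun z hz => imInner_eq_zero_of_mem_frameLattice
    (fun i => by rw [imInner_swap, h.pair, if_neg (Fin.succ_ne_zero i), neg_zero])
    (fun i => h.right _ _) hz
  have hsub : frameLattice (fun i : Fin n => e i.succ) (fun i : Fin n => f i.succ)
      ≤ frameLattice e f :=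
    frameLattice_le (fun i => left_mem_frameLattice e f _) (fun i => right_mem_frameLattice e f _)
  have huu : ∀ i j, imInner (u i) (u j) = 0 := fun i j => by
    rw [imInner_eq_imInner_projPerp (perp_e _ (hu i)) (perp_e _ (hu j)), hux, hux, hxy.left]
  have hvv : ∀ i j, imInner (v i) (v j) = 0 := fun i j => by
    rw [imInner_eq_imInner_projPerp (perp_e _ (hv i)) (perp_e _ (hv j)), hvy, hvy, hxy.right]
  have huv : ∀ i j, imInner (u i) (v j) = if i = j then 1 else 0 := fun i j => by
    rw [imInner_eq_imInner_projPerp (perp_e _ (hu i)) (perp_e _ (hv j)), hux, hvy, hxy.pair]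
  have e0 : ∀ z ∈ frameLattice (fun i : Fin n => e i.succ) (fun i : Fin n => f i.succ),
      imInner z (e 0) = 0 := fun z hz => by rw [imInner_swap, perp_e z hz, neg_zero]
  have f0 : ∀ z ∈ frameLattice (fun i : Fin n => e i.succ) (fun i : Fin n => f i.succ),
      imInner z (f 0) = 0 := fun z hz => by rw [imInner_swap, perp_f z hz, neg_zero]
  choose k hk using fun i => exists_zsmul_norm_sq_le (h.ne_zero 0) (u i)
  -- Shortening `u i` by `k i • e 0` spoils its pairing with `f 0`, which becomes `k i`. Subtracting
  -- `∑ j, k j • v j` from `f 0` restores it. The second half of the frame may become long, which is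
  -- harmless.
  refine ⟨Fin.cons (e 0) fun i => u i + k i • e 0,
    Fin.cons (f 0 + ∑ j, (-k j) • v j) v, ⟨?_, ?_, ?_⟩, ?_, ?_, rfl, fun i => ?_⟩
  · intro i j
    refine Fin.cases ?_ (fun i => ?_) i <;> refine Fin.cases ?_ (fun j => ?_) j <;>
      simp only [Fin.cons_zero, Fin.cons_succ, imInner_self, imInner_add_left, imInner_add_right,
        imInner_zsmul_left, imInner_zsmul_right, huu, perp_e _ (hu _), e0 _ (hu _)] <;> simp
  · intro i j
    refine Fin.cases ?_ (fun i => ?_) i <;> refine Fin.cases ?_ (fun j => ?_) j <;>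
      simp only [Fin.cons_zero, Fin.cons_succ, imInner_self, imInner_add_left, imInner_add_right,
        imInner_sum_left, imInner_sum_right,
        imInner_zsmul_left, imInner_zsmul_right, hvv, perp_f _ (hv _), f0 _ (hv _)] <;> simp
  · intro i j
    refine Fin.cases ?_ (fun i => ?_) i <;> refine Fin.cases ?_ (fun j => ?_) j <;>
      simp only [Fin.cons_zero, Fin.cons_succ, imInner_add_left, imInner_add_right,
        imInner_sum_right, h.pair,
        imInner_zsmul_left, imInner_zsmul_right, huv, perp_e _ (hv _), f0 _ (hu _)] <;>
      simp [Fin.succ_ne_zero, (Fin.succ_ne_zero _).symm]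
  · intro i
    refine Fin.cases (left_mem_frameLattice e f 0) (fun i => ?_) i
    exact Submodule.add_mem _ (hsub (hu i)) (Submodule.smul_mem _ _ (left_mem_frameLattice e f 0))
  · intro i
    refine Fin.cases ?_ (fun i => hsub (hv i)) i
    exact Submodule.add_mem _ (right_mem_frameLattice e f 0)
      (Submodule.sum_mem _ fun j _ => Submodule.smul_mem _ _ (hsub (hv j)))
  · have := hk i
    rwa [perp_e _ (hu i), hux, zero_pow two_ne_zero, zero_div, add_zero] at this

end Frames

/-- Every symplectic frame of an `n`-dimensional hermitian space can be changed, within the lattice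
that it spans, to one in which the first half of the vectors is bounded in terms of `n`. -/
theorem exists_bounded_frame (n : ℕ) : ∃ C : ℝ, ∀ (E : Type) [NormedAddCommGroup E]
    [InnerProductSpace ℂ E] [FiniteDimensional ℂ E], Module.finrank ℂ E = n →
    ∀ e f : Fin n → E, IsSymplecticFrame e f → ∃ a b : Fin n → E, IsSymplecticFrame a b ∧
      (∀ i, a i ∈ frameLattice e f) ∧ (∀ i, b i ∈ frameLattice e f) ∧
      ∑ i, ‖a i‖ ^ 2 ≤ C := by
  induction n with
  | zero =>
    refine ⟨0, fun E _ _ _ _ e f h => ⟨e, f, h, fun i => i.elim0, fun i => i.elim0, by simp⟩⟩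
  | succ n ih =>
    obtain ⟨C, hC⟩ := ih
    -- With `w = ‖a 0‖ ^ 2 ≤ 2 * (C + 1)`, the new frame has sum at most `w + C + n * w / 4`.
    refine ⟨C + (n + 1) * (2 * (C + 1)), fun E _ _ _ hdim e f h => ?_⟩
    obtain ⟨a, b, hab, ha, hb, hmin⟩ := exists_almost_minimal_frame e f h
    have hle : frameLattice a b ≤ frameLattice e f := frameLattice_le ha hb
    have hdim' : Module.finrank ℂ (Submodule.span ℂ {a 0})ᗮ = n :=
      haveI : Fact (Module.finrank ℂ E = n + 1) := ⟨hdim⟩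
      Submodule.finrank_orthogonal_span_singleton (hab.ne_zero 0)
    obtain ⟨x, y, hxy, hx, hy, hsum⟩ := hC _ hdim' _ _ hab.projPerp
    obtain ⟨c, d, hcd, hc, hd, hc0, hcs⟩ := hab.exists_lift hxy hx hy
    refine ⟨c, d, hcd, fun i => hle (hc i), fun i => hle (hd i), ?_⟩
    have hC0 : 0 ≤ C := le_trans (Finset.sum_nonneg fun i _ => sq_nonneg _) hsum
    have hw : ‖a 0‖ ^ 2 ≤ 2 * (C + 1) := by
      rcases hmin with h1 | hmin
      · linarith
      rcases Nat.eq_zero_or_pos n with rfl | hn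
      -- In dimension one the competitor is the rotated frame `(b 0 + k • a 0, -a 0)`. With `w = ‖a
      -- 0‖ ^ 2`, almost minimality gives `7/8 * w ≤ w/4 + 1/w`, impossible for `w > 2`.
      · obtain ⟨k, hk⟩ := exists_zsmul_norm_sq_le (hab.ne_zero 0) (b 0)
        have hsub : projPerp (a 0) (b 0) = 0 :=
          haveI := Module.finrank_zero_iff.1 hdim'
          Subsingleton.elim _ _
        rw [hsub, norm_zero, hab.pair, if_pos rfl] at hk
        have := hmin (fun _ => b 0 + k • a 0) (fun _ => -a 0) ⟨fun _ _ => imInner_self _,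
          fun _ _ => imInner_self _, fun i j => by
            rw [if_pos (Fin.ext (by omega)), imInner_neg_right, imInner_add_left,
              imInner_zsmul_left, imInner_self, imInner_swap, hab.pair, if_pos rfl]; simp⟩
          (fun _ => Submodule.add_mem _ (hb 0) (Submodule.smul_mem _ _ (ha 0)))
          (fun _ => Submodule.neg_mem _ (ha 0))
        by_contra hcon
        push Not at hcon
        have h2 : 2 < ‖a 0‖ ^ 2 := by linarith
        have h3 : (1 : ℝ) ^ 2 / ‖a 0‖ ^ 2 < 1 / 2 := by
          rw [one_pow]; exact one_div_lt_one_div_of_lt two_pos h2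
        nlinarith
      · obtain ⟨m, rfl⟩ := Nat.exists_eq_succ_of_ne_zero hn.ne'
        -- The competitor is the lifted frame with its first two pairs exchanged: `7/8 * w ≤ C +
        -- w/4` for `w = ‖a 0‖ ^ 2`.
        have := hmin _ _ (hcd.comp (Equiv.swap (0 : Fin (m + 2)) 1).injective)
          (fun i => hle (hc _)) (fun i => hle (hd _))
        rw [Function.comp_apply, Equiv.swap_apply_left] at this
        have h1 := hcs 0
        have h2 : ‖x 0‖ ^ 2 ≤ C :=
          (Finset.single_le_sum (f := fun i => ‖x i‖ ^ 2) (fun i _ => sq_nonneg _)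
            (Finset.mem_univ 0)).trans hsum
        rw [Fin.succ_zero_eq_one] at h1
        linarith
    rw [Fin.sum_univ_succ, hc0]
    have : ∑ i : Fin n, ‖c i.succ‖ ^ 2 ≤ ∑ i : Fin n, (‖x i‖ ^ 2 + ‖a 0‖ ^ 2 / 4) :=
      Finset.sum_le_sum fun i _ => hcs i
    rw [Finset.sum_add_distrib, Finset.sum_const, Finset.card_univ, Fintype.card_fin,
      nsmul_eq_mul] at this
    have hn0 : (0 : ℝ) ≤ n := n.cast_nonneg
    nlinarith

/-- The second half is listed first so that the Gram matrix is `J` with Mathlib's sign; the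
coefficients on `f` and `e` are then the blocks C and D. -/
theorem IsSymplecticFrame.imInner_sumElim {E : Type*} [NormedAddCommGroup E]
    [InnerProductSpace ℂ E] {ι : Type*} [DecidableEq ι] {e f : ι → E}
    (h : IsSymplecticFrame e f) (x y : ι ⊕ ι) :
    imInner (Sum.elim f e x) (Sum.elim f e y) = ((Matrix.J ι ℤ x y : ℤ) : ℝ) := by
  rcases x with i | i <;> rcases y with j | j <;>
    simp only [Sum.elim_inl, Sum.elim_inr, Matrix.J, Matrix.fromBlocks_apply₁₁,
      Matrix.fromBlocks_apply₁₂, Matrix.fromBlocks_apply₂₁, Matrix.fromBlocks_apply₂₂,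
      Matrix.zero_apply, Matrix.neg_apply, Matrix.one_apply]
  · simp [h.right]
  · rw [imInner_swap, h.pair]
    simp [eq_comm]
  · rw [h.pair]; simp
  · simp [h.left]

/-- Two frames of the same lattice differ by an integral symplectic matrix. -/
theorem IsSymplecticFrame.exists_symplectic {E : Type*} [NormedAddCommGroup E]
    [InnerProductSpace ℂ E] {ι : Type*} [Fintype ι] [DecidableEq ι] {e f a b : ι → E}
    (h : IsSymplecticFrame e f) (h' : IsSymplecticFrame a b)
    (ha : ∀ i, a i ∈ frameLattice e f) (hb : ∀ i, b i ∈ frameLattice e f) :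
    ∃ γ : symplecticGroup ι ℤ, ∀ i, a i =
      ∑ j, (γ : Matrix (ι ⊕ ι) (ι ⊕ ι) ℤ) (Sum.inr i) (Sum.inl j) • f j +
      ∑ j, (γ : Matrix (ι ⊕ ι) (ι ⊕ ι) ℤ) (Sum.inr i) (Sum.inr j) • e j := by
  have hspan : frameLattice e f = Submodule.span ℤ (Set.range (Sum.elim f e)) := by
    rw [frameLattice, Set.Sum.elim_range, Set.union_comm]
  have hmem : ∀ x, ∃ c : ι ⊕ ι → ℤ, ∑ y, c y • Sum.elim f e y = Sum.elim b a x := by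
    intro x
    rw [← Submodule.mem_span_range_iff_exists_fun, ← hspan]
    rcases x with i | i
    exacts [hb i, ha i]
  choose γ hγ using hmem
  -- Both frames have Gram matrix `J`, so the integral matrix expressing one by the other satisfies
  -- γ J γᵀ = J.
  refine ⟨⟨Matrix.of γ, ?_⟩, fun i => ?_⟩
  · rw [SymplecticGroup.mem_iff]
    ext x y
    have key := h'.imInner_sumElim x y
    rw [← hγ x, ← hγ y, imInner_sum_left] at key
    simp only [imInner_sum_right, imInner_zsmul_left, imInner_zsmul_right,
      h.imInner_sumElim] at key
    rw [Matrix.mul_apply]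
    simp only [Matrix.mul_apply, Finset.sum_mul, Matrix.transpose_apply, Matrix.of_apply]
    rw [Finset.sum_comm]
    have : ∑ k, ∑ l, γ x k * Matrix.J ι ℤ k l * γ y l = Matrix.J ι ℤ x y := by
      have e : ((∑ k, ∑ l, γ x k * Matrix.J ι ℤ k l * γ y l : ℤ) : ℝ) = (Matrix.J ι ℤ x y : ℤ) := by
        rw [← key]
        push_cast
        refine Finset.sum_congr rfl fun k _ => ?_
        refine Finset.sum_congr rfl fun l _ => ?_
        ring
      exact_mod_cast e
    exact this
  · have := hγ (Sum.inr i)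
    rw [Fintype.sum_sum_type] at this
    simpa using this.symm

/-! ### The symplectic frame of a point of the upper half space -/

open scoped MatrixOrder in
/-- The square root is hermitian and squares to `Y`. -/
theorem posDefSqrt_mul_conjTranspose {n : ℕ} (Y : Matrix (Fin n) (Fin n) ℝ) (hY : Y.PosDef) :
    (posDefSqrt Y hY : Matrix (Fin n) (Fin n) ℂ)ᴴ = posDefSqrt Y hY ∧
    (posDefSqrt Y hY : Matrix (Fin n) (Fin n) ℂ) * posDefSqrt Y hY = Y.map ((↑) : ℝ → ℂ) := by
  have e : (posDefSqrt Y hY : Matrix (Fin n) (Fin n) ℂ) = (CFC.sqrt Y).map ((↑) : ℝ → ℂ) := rfl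
  rw [e]
  constructor
  · have h1 : (CFC.sqrt Y)ᴴ = CFC.sqrt Y := (CFC.sqrt_nonneg Y).posSemidef.1
    conv_rhs => rw [← h1]
    ext i j
    simp
  · have h2 := CFC.sqrt_mul_sqrt_self Y hY.posSemidef.nonneg
    conv_rhs => rw [← h2]
    ext i j
    simp [Matrix.mul_apply]

/-- The rows of a matrix as vectors of a euclidean space. -/
noncomputable def rowVec {n : ℕ} (A : Matrix (Fin n) (Fin n) ℂ) (i : Fin n) :
    EuclideanSpace ℂ (Fin n) := WithLp.toLp 2 (A i)

theorem inner_rowVec {n : ℕ} (A B : Matrix (Fin n) (Fin n) ℂ) (i j : Fin n) :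
    inner ℂ (rowVec A i) (rowVec B j) = (B * Aᴴ) j i := by
  simp [rowVec, Matrix.mul_apply, PiLp.inner_apply]

theorem norm_sq_rowVec {n : ℕ} (A : Matrix (Fin n) (Fin n) ℂ) (i : Fin n) :
    ‖rowVec A i‖ ^ 2 = ∑ j, ‖A i j‖ ^ 2 := by
  simp [rowVec, EuclideanSpace.norm_sq_eq]

theorem eq_re_add_im {n : ℕ} (Z : Matrix (Fin n) (Fin n) ℂ) :
    Z = (Z.map Complex.re).map ((↑) : ℝ → ℂ) +
      Complex.I • (Z.map Complex.im).map ((↑) : ℝ → ℂ) := by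
  ext i j
  simp [mul_comm Complex.I, Complex.re_add_im]

/-- The rows of `Y^{-1/2}` and `Z Y^{-1/2}` form a symplectic frame. -/
theorem isSymplecticFrame_rowVec {n : ℕ} (Z : SiegelSpace n) (s : GL (Fin n) ℂ)
    (hs : (s : Matrix (Fin n) (Fin n) ℂ)ᴴ = s)
    (hsq : (s : Matrix (Fin n) (Fin n) ℂ) * s = (imPart Z).map ((↑) : ℝ → ℂ)) :
    IsSymplecticFrame (rowVec ((s⁻¹ : GL (Fin n) ℂ) : Matrix (Fin n) (Fin n) ℂ))
      (rowVec ((Z : Matrix (Fin n) (Fin n) ℂ) * ((s⁻¹ : GL (Fin n) ℂ) : Matrix (Fin n) (Fin n) ℂ)))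
    := by
  set t : Matrix (Fin n) (Fin n) ℂ := ((s⁻¹ : GL (Fin n) ℂ) : Matrix (Fin n) (Fin n) ℂ) with ht
  set Y := imPart Z with hY
  set X : Matrix (Fin n) (Fin n) ℝ := (Z : Matrix (Fin n) (Fin n) ℂ).map Complex.re with hX
  have hts : t * s = 1 := by rw [ht, ← Units.val_mul, inv_mul_cancel, Units.val_one]
  have hst : (s : Matrix (Fin n) (Fin n) ℂ) * t = 1 := by
    rw [ht, ← Units.val_mul, mul_inv_cancel, Units.val_one]
  have hu : IsUnit Y.det := (Matrix.isUnit_iff_isUnit_det _).1 (imPart_posDef Z).isUnit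
  have hth : tᴴ = t := by
    have h1 := congrArg conjTranspose hts
    rw [conjTranspose_mul, hs, conjTranspose_one] at h1
    calc tᴴ = (t * s) * tᴴ := by rw [hts, one_mul]
      _ = t := by rw [mul_assoc, h1, mul_one]
  have htt : t * tᴴ = Y⁻¹.map ((↑) : ℝ → ℂ) := by
    have h1 : Y⁻¹.map ((↑) : ℝ → ℂ) * Y.map ((↑) : ℝ → ℂ) = 1 := by
      have := congrArg (Complex.ofRealHom.mapMatrix (m := Fin n)) (Matrix.nonsing_inv_mul Y hu)
      rw [map_mul, map_one] at this
      exact this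
    rw [hth]
    calc t * t = (Y⁻¹.map ((↑) : ℝ → ℂ) * Y.map ((↑) : ℝ → ℂ)) * (t * t) := by rw [h1, one_mul]
      _ = Y⁻¹.map ((↑) : ℝ → ℂ) * (s * (s * t) * t) := by rw [← hsq]; noncomm_ring
      _ = _ := by rw [hst, mul_one, hst, mul_one]
  have hZ : (Z : Matrix (Fin n) (Fin n) ℂ) =
      X.map ((↑) : ℝ → ℂ) + Complex.I • Y.map ((↑) : ℝ → ℂ) := eq_re_add_im _
  have hXT : Xᵀ = X := by
    ext i j
    have := congrFun (congrFun Z.2.1 i) j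
    simpa [hX] using congrArg Complex.re this
  have hYT : Yᵀ = Y := by
    ext i j
    have := congrFun (congrFun Z.2.1 i) j
    simpa [hY, imPart] using congrArg Complex.im this
  have hmapmul : ∀ A B : Matrix (Fin n) (Fin n) ℝ, A.map ((↑) : ℝ → ℂ) * B.map ((↑) : ℝ → ℂ)
      = (A * B).map ((↑) : ℝ → ℂ) := fun A B => (map_mul (Complex.ofRealHom.mapMatrix) A B).symm
  have hconj : ∀ A : Matrix (Fin n) (Fin n) ℝ, (A.map ((↑) : ℝ → ℂ))ᴴ = Aᵀ.map ((↑) : ℝ → ℂ) := by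
    intro A; ext i j; simp
  have h1 : (Z : Matrix (Fin n) (Fin n) ℂ) * t * tᴴ
      = (X * Y⁻¹).map ((↑) : ℝ → ℂ) + Complex.I • (1 : Matrix (Fin n) (Fin n) ℝ).map (↑) := by
    rw [mul_assoc, htt, hZ, add_mul, smul_mul_assoc, hmapmul, hmapmul, Matrix.mul_nonsing_inv _ hu]
  -- The three Gram blocks are Y⁻¹ and X Y⁻¹ X + Y, both real, and X Y⁻¹ + i, with imaginary part
  -- the identity.
  refine ⟨fun i j => ?_, fun i j => ?_, fun i j => ?_⟩
  · rw [imInner, inner_rowVec, htt]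
    simp
  · rw [imInner, inner_rowVec, conjTranspose_mul, ← mul_assoc, h1, hZ, conjTranspose_add,
      conjTranspose_smul, hconj, hconj, hXT, hYT]
    have : ((X * Y⁻¹).map ((↑) : ℝ → ℂ) + Complex.I • (1 : Matrix (Fin n) (Fin n) ℝ).map (↑)) *
        (X.map ((↑) : ℝ → ℂ) + star Complex.I • Y.map ((↑) : ℝ → ℂ))
        = (X * Y⁻¹ * X + Y).map ((↑) : ℝ → ℂ) := by
      rw [add_mul, mul_add, mul_add, smul_mul_assoc, smul_mul_assoc, mul_smul_comm, mul_smul_comm,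
        hmapmul, hmapmul, hmapmul, hmapmul, mul_assoc, mul_assoc X, Matrix.nonsing_inv_mul _ hu]
      ext i j
      simp
      ring_nf
      simp
    rw [this]
    simp
  · rw [imInner, inner_rowVec, h1]
    simp [Matrix.one_apply, eq_comm]
    split_ifs <;> simp

/-- Reduction theory for `Sp_{2n}(ℤ)`: a bound for `(CZ+D)Y^{-1/2}`. -/
theorem exists_reduced_point (n : ℕ) : ∃ C : ℝ, ∀ Z : SiegelSpace n,
    ∃ γ : symplecticGroup (Fin n) ℤ, ∑ i, ∑ j,
      ‖(denomMatrix (symplecticMap n (Int.castRingHom ℝ) γ) Z *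
        (((posDefSqrt (imPart Z) (imPart_posDef Z))⁻¹ : GL (Fin n) ℂ) :
          Matrix (Fin n) (Fin n) ℂ)) i j‖ ^ 2 ≤ C := by
  obtain ⟨C, hC⟩ := exists_bounded_frame n
  refine ⟨C, fun Z => ?_⟩
  obtain ⟨h1, h2⟩ := posDefSqrt_mul_conjTranspose (imPart Z) (imPart_posDef Z)
  have hfr := isSymplecticFrame_rowVec Z _ h1 h2
  obtain ⟨a, b, hab, ha, hb, hsum⟩ := hC (EuclideanSpace ℂ (Fin n)) (by simp) _ _ hfr
  obtain ⟨γ, hγ⟩ := hfr.exists_symplectic hab ha hb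
  refine ⟨γ, le_of_eq_of_le ?_ hsum⟩
  refine Finset.sum_congr rfl fun i _ => ?_
  rw [← norm_sq_rowVec]
  congr 2
  rw [hγ i]
  ext j
  simp only [denomMatrix, rowVec, Matrix.add_mul, Matrix.add_apply, PiLp.add_apply, WithLp.ofLp_sum,
    Finset.sum_apply, Matrix.mul_assoc]
  rw [Matrix.mul_apply, Matrix.mul_apply]
  simp [blockC, blockD, symplecticMap, Matrix.toBlocks₂₁, Matrix.toBlocks₂₂]

/-! ### Lower bounds for the determinant of the factor of automorphy -/

/-- The root t = -1/κ must satisfy Im t ≤ -1. Equivalently, κ lies in the closed disc with diameter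
from -i to 0. -/
theorem normSq_le_neg_im {κ : ℂ} (h : ∀ t : ℂ, -1 < t.im → 1 + t * κ ≠ 0) :
    Complex.normSq κ ≤ -κ.im := by
  by_contra hcon
  push Not at hcon
  have hκ : κ ≠ 0 := by rintro rfl; simp at hcon
  have hq : 0 < Complex.normSq κ := Complex.normSq_pos.2 hκ
  refine h (-κ⁻¹) ?_ (by field_simp; ring)
  rw [Complex.neg_im, Complex.inv_im, neg_div, neg_neg, lt_div_iff₀ hq]
  linarith

/-- By the disc description of κ, the number 1 + (μ - 1)iκ lies in the disc whose diameter is the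
real segment between 1 and μ. -/
theorem min_le_norm_one_add_mul {κ : ℂ} (h : ∀ t : ℂ, -1 < t.im → 1 + t * κ ≠ 0) {μ : ℝ}
    (hμ : 0 < μ) : min μ 1 ≤ ‖1 + (μ * Complex.I - Complex.I) * κ‖ := by
  have key := normSq_le_neg_im h
  refine (pow_le_pow_iff_left₀ (le_min hμ.le zero_le_one) (norm_nonneg _) two_ne_zero).1 ?_
  rw [← Complex.normSq_eq_norm_sq]
  rw [Complex.normSq_apply] at key ⊢
  simp only [Complex.add_re, Complex.one_re, Complex.mul_re, Complex.sub_re, Complex.ofReal_re,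
    Complex.I_re, Complex.ofReal_im, Complex.I_im, Complex.sub_im, Complex.mul_im,
    Complex.add_im, Complex.one_im]
  have hr0 : 0 ≤ -κ.im := by nlinarith [mul_self_nonneg κ.re, mul_self_nonneg κ.im]
  have hr1 : -κ.im ≤ 1 := by nlinarith [mul_self_nonneg κ.re]
  rcases le_total μ 1 with h1 | h1
  · rw [min_eq_left h1]
    nlinarith [mul_nonneg (sub_nonneg.2 h1) hμ.le, mul_self_nonneg κ.re,
      mul_nonneg (mul_nonneg (sub_nonneg.2 h1) hμ.le) (by linarith : 0 ≤ 1 + κ.im),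
      mul_nonneg (sub_nonneg.2 h1) (by linarith : 0 ≤ 1 + κ.im),
      mul_nonneg (mul_self_nonneg (1 - μ)) (mul_self_nonneg (1 + κ.im)),
      mul_nonneg (mul_self_nonneg (1 - μ)) (mul_self_nonneg κ.re)]
  · rw [min_eq_right h1]
    nlinarith [mul_nonneg (sub_nonneg.2 h1) hr0, mul_nonneg (mul_self_nonneg (1 - μ))
      (mul_self_nonneg κ.im), mul_nonneg (mul_self_nonneg (1 - μ)) (mul_self_nonneg κ.re)]

/-- Taking the imaginary part of κ̄(1 + ξκ) gives |κ| ≤ |1 + ξκ|; combine this with 1 ≤ |1 + ξκ| +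
|ξ||κ|. -/
theorem inv_le_norm_one_add_mul {κ : ℂ} (h : ∀ t : ℂ, -1 < t.im → 1 + t * κ ≠ 0) (ξ : ℝ) :
    (1 + |ξ|)⁻¹ ≤ ‖1 + ((ξ + Complex.I) - Complex.I) * κ‖ := by
  have key := normSq_le_neg_im h
  rw [add_sub_cancel_right, inv_le_iff_one_le_mul₀ (by positivity)]
  have h1 : ‖κ‖ ≤ ‖1 + ξ * κ‖ := by
    rcases eq_or_ne κ 0 with rfl | hκ
    · simp
    have h2 := Complex.abs_im_le_norm ((starRingEnd ℂ) κ * (1 + ξ * κ))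
    have e : ((starRingEnd ℂ) κ * (1 + ξ * κ)).im = -κ.im := by
      simp; ring
    rw [e, norm_mul, RCLike.norm_conj] at h2
    have h3 := (le_abs_self _).trans h2
    rw [Complex.normSq_eq_norm_sq] at key
    have : ‖κ‖ * ‖κ‖ ≤ ‖κ‖ * ‖1 + ξ * κ‖ := by nlinarith
    exact le_of_mul_le_mul_left this (norm_pos_iff.2 hκ)
  have h2 : (1 : ℝ) ≤ ‖1 + ξ * κ‖ + |ξ| * ‖κ‖ := by
    have := norm_sub_le (1 + ξ * κ) (ξ * κ)
    rw [add_sub_cancel_right, norm_one, norm_mul, Complex.norm_real, Real.norm_eq_abs] at this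
    exact this
  nlinarith [abs_nonneg ξ]

/-- The matrix determinant lemma: along a rank one direction the determinant is affine in the
parameter. -/
theorem exists_det_add_smul_vecMulVec {n : ℕ} (g : symplecticGroup (Fin n) ℝ) (Z : SiegelSpace n)
    (u : Fin n → ℂ) : ∃ κ : ℂ, ∀ t : ℂ,
      (blockC g * ((Z : Matrix (Fin n) (Fin n) ℂ) + t • vecMulVec u u) + blockD g).det
        = (denomMatrix g Z).det * (1 + t * κ) := by
  have hu := (Matrix.isUnit_iff_isUnit_det _).1 (isUnit_denomMatrix g Z)
  refine ⟨(replicateRow Unit u * (denomMatrix g Z)⁻¹ * replicateCol Unit (blockC g *ᵥ u)).det,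
    fun t => ?_⟩
  have h := Matrix.det_add_replicateCol_mul_replicateRow (ι := Unit) hu (t • blockC g *ᵥ u) u
  have e : blockC g * ((Z : Matrix (Fin n) (Fin n) ℂ) + t • vecMulVec u u) + blockD g
      = denomMatrix g Z + replicateCol Unit (t • blockC g *ᵥ u) * replicateRow Unit u := by
    rw [← Matrix.vecMulVec_eq, denomMatrix, Matrix.mul_add, Matrix.mul_smul, Matrix.smul_vecMulVec,
      Matrix.mul_vecMulVec]
    abel
  rw [e, h, replicateCol_smul, Matrix.mul_smul]
  simp [Matrix.det_unique]

/-- The point `W + Q diag(z) Qᵀ`. -/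
noncomputable def diagPoint {n : ℕ} (W Q : Matrix (Fin n) (Fin n) ℝ) (z : Fin n → ℂ) :
    Matrix (Fin n) (Fin n) ℂ :=
  W.map (↑) + Q.map (↑) * diagonal z * (Q.map (↑))ᵀ

theorem diagPoint_mem {n : ℕ} {W Q : Matrix (Fin n) (Fin n) ℝ} (hW : Wᵀ = W)
    (hQ : IsUnit Q) {z : Fin n → ℂ} (hz : ∀ i, 0 < (z i).im) :
    diagPoint W Q z ∈ siegelSet n := by
  constructor
  · simp only [diagPoint, transpose_add, transpose_mul, transpose_transpose, diagonal_transpose,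
      Matrix.mul_assoc]
    rw [← transpose_map, hW]
  · have e : (diagPoint W Q z).map Complex.im = Q * diagonal (fun i => (z i).im) * Qᴴ := by
      ext i j
      simp [diagPoint, Matrix.mul_apply, Matrix.diagonal_apply]
    rw [e]
    exact (PosDef.diagonal hz).mul_mul_conjTranspose_same
      (Matrix.vecMul_injective_iff_isUnit.2 hQ)

theorem diagPoint_update {n : ℕ} (W Q : Matrix (Fin n) (Fin n) ℝ) (z : Fin n → ℂ) (a : Fin n)
    (w : ℂ) : diagPoint W Q (Function.update z a w) = diagPoint W Q z +
      (w - z a) • vecMulVec (fun i => (Q i a : ℂ)) (fun i => (Q i a : ℂ)) := by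
  ext i j
  simp only [diagPoint, Matrix.add_apply, Matrix.smul_apply, vecMulVec_apply, add_assoc]
  congr 1
  rw [Matrix.mul_apply, Matrix.mul_apply, ← sub_eq_iff_eq_add', ← Finset.sum_sub_distrib]
  rw [Finset.sum_eq_single a]
  · simp; ring
  · intro b _ hb
    simp [Function.update_of_ne hb]
  · simp

/-- A Harnack type inequality for `|det(CZ+D)|`: the diagonal entries are moved one at a time. -/
theorem prod_mul_norm_det_le {n : ℕ} (g : symplecticGroup (Fin n) ℝ)
    {W Q : Matrix (Fin n) (Fin n) ℝ} (hW : Wᵀ = W) (hQ : IsUnit Q) {z : Fin n → ℂ}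
    (hz : ∀ i, 0 < (z i).im) (m : Fin n → ℝ) (hm0 : ∀ i, 0 ≤ m i)
    (hm : ∀ i, ∀ κ : ℂ, (∀ t : ℂ, -1 < t.im → 1 + t * κ ≠ 0) →
      m i ≤ ‖1 + (z i - Complex.I) * κ‖) :
    (∏ i, m i) * ‖(blockC g * diagPoint W Q (fun _ => Complex.I) + blockD g).det‖ ≤
      ‖(blockC g * diagPoint W Q z + blockD g).det‖ := by
  have key : ∀ s : Finset (Fin n),
      (∏ i ∈ s, m i) * ‖(blockC g * diagPoint W Q (fun _ => Complex.I) + blockD g).det‖ ≤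
        ‖(blockC g * diagPoint W Q (s.piecewise z fun _ => Complex.I) + blockD g).det‖ := by
    intro s
    induction s using Finset.induction_on with
    | empty => simp
    | insert a s ha ih =>
      set y := s.piecewise z fun _ => Complex.I with hy
      have hya : y a = Complex.I := Finset.piecewise_eq_of_notMem _ _ _ ha
      have hypos : ∀ i, 0 < (y i).im := fun i => by
        by_cases hi : i ∈ s
        · rw [hy, Finset.piecewise_eq_of_mem _ _ _ hi]; exact hz i
        · rw [hy, Finset.piecewise_eq_of_notMem _ _ _ hi]; simp
      set Z : SiegelSpace n := ⟨_, diagPoint_mem hW hQ hypos⟩ with hZ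
      obtain ⟨κ, hκ⟩ := exists_det_add_smul_vecMulVec g Z (fun i => (Q i a : ℂ))
      have hup : ∀ w, blockC g * diagPoint W Q (Function.update y a w) + blockD g
          = blockC g * ((Z : Matrix (Fin n) (Fin n) ℂ) +
            (w - Complex.I) • vecMulVec (fun i => (Q i a : ℂ)) (fun i => (Q i a : ℂ)))
              + blockD g := fun w => by rw [diagPoint_update, hya]
      -- The moved entry is t + i, so Im t > -1 means that the point stays in the upper half space,
      -- where det(CZ+D) does not vanish.
      have hne : ∀ t : ℂ, -1 < t.im → 1 + t * κ ≠ 0 := by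
        intro t ht h0
        have hpos : ∀ i, 0 < (Function.update y a (t + Complex.I) i).im := fun i => by
          rcases eq_or_ne i a with rfl | hi
          · simp; linarith
          · rw [Function.update_of_ne hi]; exact hypos i
        have hu := (Matrix.isUnit_iff_isUnit_det _).1
          (isUnit_denomMatrix g ⟨_, diagPoint_mem hW hQ hpos⟩)
        rw [denomMatrix, hup, add_sub_cancel_right, hκ, h0, mul_zero] at hu
        simp at hu
      rw [Finset.prod_insert ha, Finset.piecewise_insert, hup, hκ, norm_mul, mul_assoc, mul_comm]
      exact mul_le_mul ih (hm a κ hne) (hm0 a) (norm_nonneg _)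
  simpa using key Finset.univ

/-- The determinant of Ci + D is a nonzero Gaussian integer. -/
theorem one_le_norm_det_I {n : ℕ} (γ : symplecticGroup (Fin n) ℤ) :
    1 ≤ ‖(blockC (symplecticMap n (Int.castRingHom ℝ) γ) * (Complex.I • 1) +
      blockD (symplecticMap n (Int.castRingHom ℝ) γ)).det‖ := by
  set g := symplecticMap n (Int.castRingHom ℝ) γ with hg
  have hmem : (Complex.I • (1 : Matrix (Fin n) (Fin n) ℂ)) ∈ siegelSet n := by
    refine ⟨by simp, ?_⟩
    have : (Complex.I • (1 : Matrix (Fin n) (Fin n) ℂ)).map Complex.im = 1 := by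
      ext i j
      simp [Matrix.one_apply]
      split_ifs <;> simp
    rw [this]
    exact PosDef.one
  have hu := (Matrix.isUnit_iff_isUnit_det _).1 (isUnit_denomMatrix g ⟨_, hmem⟩)
  set M : Matrix (Fin n) (Fin n) GaussianInt := Matrix.of fun i j =>
    (⟨(γ : Matrix (Fin n ⊕ Fin n) (Fin n ⊕ Fin n) ℤ) (Sum.inr i) (Sum.inr j),
      (γ : Matrix (Fin n ⊕ Fin n) (Fin n ⊕ Fin n) ℤ) (Sum.inr i) (Sum.inl j)⟩ : GaussianInt)
  have e : blockC g * (Complex.I • 1) + blockD g = GaussianInt.toComplex.mapMatrix M := by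
    ext i j
    simp [M, GaussianInt.toComplex_def, blockC, blockD, hg, symplecticMap, Matrix.toBlocks₂₁,
      Matrix.toBlocks₂₂]
    ring
  have hu' : (blockC g * (Complex.I • 1) + blockD g).det ≠ 0 := hu.ne_zero
  rw [e, ← RingHom.map_det] at hu' ⊢
  have h0 : M.det ≠ 0 := fun h => hu' (by rw [h, map_zero])
  have h1 : 0 < M.det.norm := GaussianInt.norm_pos.2 h0
  have h2 := GaussianInt.intCast_real_norm M.det
  have h3 : (1 : ℝ) ≤ (M.det.norm : ℝ) := by exact_mod_cast h1
  rw [h2, Complex.normSq_eq_norm_sq] at h3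
  nlinarith [norm_nonneg (GaussianInt.toComplex M.det)]

/-! ### Diagonalisation of real symmetric matrices and the lower bound for det(CZ+D) -/

theorem eq_eigenvectorUnitary_mul {n : ℕ} {A : Matrix (Fin n) (Fin n) ℝ} (hA : A.IsHermitian) :
    A = (hA.eigenvectorUnitary : Matrix (Fin n) (Fin n) ℝ) * diagonal hA.eigenvalues *
      (hA.eigenvectorUnitary : Matrix (Fin n) (Fin n) ℝ)ᵀ := by
  conv_lhs => rw [hA.spectral_theorem]
  rw [Unitary.conjStarAlgAut_apply]
  rfl

theorem eigenvectorUnitary_mul_transpose {n : ℕ} {A : Matrix (Fin n) (Fin n) ℝ}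
    (hA : A.IsHermitian) : (hA.eigenvectorUnitary : Matrix (Fin n) (Fin n) ℝ) *
      (hA.eigenvectorUnitary : Matrix (Fin n) (Fin n) ℝ)ᵀ = 1 :=
  Unitary.mul_star_self_of_mem hA.eigenvectorUnitary.2

theorem transpose_mul_eigenvectorUnitary {n : ℕ} {A : Matrix (Fin n) (Fin n) ℝ}
    (hA : A.IsHermitian) : (hA.eigenvectorUnitary : Matrix (Fin n) (Fin n) ℝ)ᵀ *
      (hA.eigenvectorUnitary : Matrix (Fin n) (Fin n) ℝ) = 1 :=
  Unitary.star_mul_self_of_mem hA.eigenvectorUnitary.2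

theorem isUnit_eigenvectorUnitary {n : ℕ} {A : Matrix (Fin n) (Fin n) ℝ}
    (hA : A.IsHermitian) : IsUnit (hA.eigenvectorUnitary : Matrix (Fin n) (Fin n) ℝ) :=
  ⟨⟨_, _, eigenvectorUnitary_mul_transpose hA, transpose_mul_eigenvectorUnitary hA⟩, rfl⟩

theorem abs_eigenvalues_le {n : ℕ} {A : Matrix (Fin n) (Fin n) ℝ} (hA : A.IsHermitian)
    (h : ∀ i j, |A i j| ≤ 1) (i : Fin n) : |hA.eigenvalues i| ≤ n ^ 2 := by
  set Q := (hA.eigenvectorUnitary : Matrix (Fin n) (Fin n) ℝ) with hQ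
  have e : diagonal hA.eigenvalues = Qᵀ * A * Q := by
    conv_rhs => rw [eq_eigenvectorUnitary_mul hA, ← hQ]
    rw [mul_assoc, mul_assoc, transpose_mul_eigenvectorUnitary, mul_one, ← mul_assoc,
      transpose_mul_eigenvectorUnitary, one_mul]
  have hQ1 : ∀ k l, |Q k l| ≤ 1 := fun k l => entry_norm_bound_of_unitary hA.eigenvectorUnitary.2 k l
  have := congrFun (congrFun e i) i
  rw [diagonal_apply_eq] at this
  rw [this, Matrix.mul_apply]
  simp only [Matrix.mul_apply, Finset.sum_mul, transpose_apply]
  calc |∑ k, ∑ l, Q l i * A l k * Q k i| ≤ ∑ k, ∑ l, |Q l i * A l k * Q k i| :=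
        (Finset.abs_sum_le_sum_abs _ _).trans
          (Finset.sum_le_sum fun k _ => Finset.abs_sum_le_sum_abs _ _)
    _ ≤ ∑ k : Fin n, ∑ l : Fin n, (1 : ℝ) := by
        refine Finset.sum_le_sum fun k _ => Finset.sum_le_sum fun l _ => ?_
        rw [abs_mul, abs_mul]
        exact mul_le_one₀ (mul_le_one₀ (hQ1 _ _) (abs_nonneg _) (h _ _)) (abs_nonneg _) (hQ1 _ _)
    _ = n ^ 2 := by simp [sq]

theorem diagPoint_of_mul_transpose {n : ℕ} (W : Matrix (Fin n) (Fin n) ℝ)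
    {Q : Matrix (Fin n) (Fin n) ℝ} (hQ : Q * Qᵀ = 1) (d : Fin n → ℝ) (c : ℂ) (x : ℂ) :
    diagPoint W Q (fun i => d i * c + x) =
      W.map (↑) + c • (Q * diagonal d * Qᵀ).map (↑) + x • 1 := by
  have h1 : diagonal (fun i => (d i : ℂ) * c + x) = c • (diagonal d).map (↑) + x • 1 := by
    ext i j
    by_cases h : i = j <;> simp [h, mul_comm]
  have h2 : (Q.map (↑) : Matrix (Fin n) (Fin n) ℂ) * (Q.map (↑))ᵀ = 1 := by
    have := congrArg (Complex.ofRealHom.mapMatrix (m := Fin n)) hQ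
    rw [map_mul, map_one] at this
    exact this
  have h3 : (Q * diagonal d * Qᵀ).map ((↑) : ℝ → ℂ)
      = Q.map (↑) * (diagonal d).map (↑) * (Q.map (↑))ᵀ := by
    have : (Q * diagonal d * Qᵀ).map ((↑) : ℝ → ℂ) = _ :=
      map_mul (Complex.ofRealHom.mapMatrix (m := Fin n)) (Q * diagonal d) Qᵀ
    rw [this, map_mul]
    rfl
  rw [diagPoint, h1, h3, Matrix.mul_add, Matrix.add_mul, mul_smul_comm, mul_smul_comm,
    smul_mul_assoc, smul_mul_assoc, mul_one, h2, add_assoc]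

/-- In an orthonormal eigenbasis of Y, move the diagonal entries from i to iμ_i, keeping X fixed;
each move costs a factor min(μ_i, 1). -/
theorem mul_norm_det_re_le {n : ℕ} (g : symplecticGroup (Fin n) ℝ) (Z : SiegelSpace n) :
    (∏ i, min ((imPart_posDef Z).isHermitian.eigenvalues i) 1) *
      ‖(blockC g * (((Z : Matrix (Fin n) (Fin n) ℂ).map Complex.re).map ((↑) : ℝ → ℂ) + Complex.I • 1) +
        blockD g).det‖ ≤ ‖(denomMatrix g Z).det‖ := by
  set hY := (imPart_posDef Z).isHermitian
  set X := (Z : Matrix (Fin n) (Fin n) ℂ).map Complex.re with hX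
  have hXT : Xᵀ = X := by
    ext i j
    have := congrFun (congrFun Z.2.1 i) j
    simpa [hX] using congrArg Complex.re this
  have hQ := eigenvectorUnitary_mul_transpose hY
  have hpos := (imPart_posDef Z).eigenvalues_pos
  have h1 := prod_mul_norm_det_le g hXT (isUnit_eigenvectorUnitary hY)
    (z := fun i => hY.eigenvalues i * Complex.I) (fun i => by simpa using hpos i)
    (fun i => min (hY.eigenvalues i) 1) (fun i => le_min (hpos i).le zero_le_one)
    (fun i κ h => min_le_norm_one_add_mul h (hpos i))
  have e1 := diagPoint_of_mul_transpose X hQ hY.eigenvalues Complex.I 0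
  have e2 := diagPoint_of_mul_transpose X hQ hY.eigenvalues 0 Complex.I
  simp only [add_zero, mul_zero, zero_smul, zero_add] at e1 e2
  rw [e1, e2, ← eq_eigenvectorUnitary_mul hY] at h1
  rw [denomMatrix, eq_re_add_im (Z : Matrix (Fin n) (Fin n) ℂ)]
  exact h1

/-- In an orthonormal eigenbasis of X, move from i to X + i; each eigenvalue is at most n² in
absolute value, and at the base point the determinant has absolute value at least 1. -/
theorem inv_pow_le_norm_det_of_abs_le {n : ℕ} (γ : symplecticGroup (Fin n) ℤ)
    {X : Matrix (Fin n) (Fin n) ℝ} (hX : Xᵀ = X) (hX1 : ∀ i j, |X i j| ≤ 1) :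
    (1 + (n : ℝ) ^ 2)⁻¹ ^ n ≤ ‖(blockC (symplecticMap n (Int.castRingHom ℝ) γ) *
      (X.map ((↑) : ℝ → ℂ) + Complex.I • 1) + blockD (symplecticMap n (Int.castRingHom ℝ) γ)).det‖ := by
  set g := symplecticMap n (Int.castRingHom ℝ) γ with hg
  have hH : X.IsHermitian := by rw [Matrix.IsHermitian, conjTranspose_eq_transpose_of_trivial, hX]
  have hQ := eigenvectorUnitary_mul_transpose hH
  have h1 := prod_mul_norm_det_le g (W := 0) (by simp) (isUnit_eigenvectorUnitary hH)
    (z := fun i => hH.eigenvalues i + Complex.I) (fun i => by simp)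
    (fun i => (1 + |hH.eigenvalues i|)⁻¹) (fun i => by positivity)
    (fun i κ h => inv_le_norm_one_add_mul h _)
  have e1 := diagPoint_of_mul_transpose 0 hQ hH.eigenvalues 1 Complex.I
  have e2 := diagPoint_of_mul_transpose 0 hQ hH.eigenvalues 0 Complex.I
  have e0 : (0 : Matrix (Fin n) (Fin n) ℝ).map ((↑) : ℝ → ℂ) = 0 := by ext i j; simp
  simp only [mul_one, one_smul, mul_zero, zero_smul, zero_add, e0] at e1 e2
  rw [e1, e2, ← eq_eigenvectorUnitary_mul hH] at h1
  refine le_trans ?_ h1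
  have h2 := one_le_norm_det_I γ
  rw [← hg] at h2
  refine le_trans ?_ (le_mul_of_one_le_right (Finset.prod_nonneg fun i _ => by positivity) h2)
  calc (1 + (n : ℝ) ^ 2)⁻¹ ^ n = ∏ _i : Fin n, (1 + (n : ℝ) ^ 2)⁻¹ := by simp
    _ ≤ _ := Finset.prod_le_prod (fun i _ => by positivity) fun i _ => by
      gcongr
      exact abs_eigenvalues_le hH hX1 i

/-- The translation `Z ↦ Z + S`. -/
def translation {n : ℕ} (S : Matrix (Fin n) (Fin n) ℤ) (hS : Sᵀ = S) :
    symplecticGroup (Fin n) ℤ :=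
  ⟨fromBlocks 1 S 0 1, by simp [SymplecticGroup.fromBlocks_mem_iff, hS]⟩

/-- An integral translation, absorbed into γ, makes the entries of X at most 1/2 in absolute value.
-/
theorem inv_pow_le_norm_det {n : ℕ} (γ : symplecticGroup (Fin n) ℤ)
    {X : Matrix (Fin n) (Fin n) ℝ} (hX : Xᵀ = X) :
    (1 + (n : ℝ) ^ 2)⁻¹ ^ n ≤ ‖(blockC (symplecticMap n (Int.castRingHom ℝ) γ) *
      (X.map ((↑) : ℝ → ℂ) + Complex.I • 1) + blockD (symplecticMap n (Int.castRingHom ℝ) γ)).det‖ := by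
  set S : Matrix (Fin n) (Fin n) ℤ := X.map round with hS
  have hST : Sᵀ = S := by rw [hS, ← transpose_map, hX]
  set X' : Matrix (Fin n) (Fin n) ℝ := X - S.map (↑) with hX'
  have hXT : X'ᵀ = X' := by rw [hX', transpose_sub, hX, ← transpose_map, hST]
  have h := inv_pow_le_norm_det_of_abs_le (γ * translation S hST) hXT (fun i j => by
    have := abs_sub_round (X i j)
    simp only [hX', hS, Matrix.sub_apply, Matrix.map_apply]
    linarith)
  set g := symplecticMap n (Int.castRingHom ℝ) γ with hg
  have hb : ∀ M : Matrix (Fin n ⊕ Fin n) (Fin n ⊕ Fin n) ℤ,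
      (M * fromBlocks 1 S 0 1).toBlocks₂₁ = M.toBlocks₂₁ ∧
      (M * fromBlocks 1 S 0 1).toBlocks₂₂ = M.toBlocks₂₁ * S + M.toBlocks₂₂ := by
    intro M
    conv in (occs := *) M * _ => all_goals rw [← fromBlocks_toBlocks M, fromBlocks_multiply]
    simp
  have hC : blockC (symplecticMap n (Int.castRingHom ℝ) (γ * translation S hST)) = blockC g := by
    have := (hb γ).1
    ext i j
    simpa [blockC, symplecticMap, hg, toBlocks₂₁, translation] using
      congrArg (fun x : ℤ => (x : ℂ)) (congrFun (congrFun this i) j)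
  have hD : blockD (symplecticMap n (Int.castRingHom ℝ) (γ * translation S hST))
      = blockC g * (S.map (↑) : Matrix (Fin n) (Fin n) ℝ).map (↑) + blockD g := by
    have := (hb γ).2
    ext i j
    simpa [blockC, blockD, symplecticMap, hg, toBlocks₂₁, toBlocks₂₂, translation, Matrix.mul_apply]
      using congrArg (fun x : ℤ => (x : ℂ)) (congrFun (congrFun this i) j)
  rw [hC, hD] at h
  have e : X.map ((↑) : ℝ → ℂ) = X'.map (↑) + (S.map (↑) : Matrix (Fin n) (Fin n) ℝ).map (↑) := by
    ext i j; simp [hX']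
  rw [e]
  convert h using 3
  noncomm_ring

/-- The lower bound for `|det(CZ+D)|` in terms of the eigenvalues of `Y`. -/
theorem prod_min_le_norm_det_denomMatrix {n : ℕ} (γ : symplecticGroup (Fin n) ℤ)
    (Z : SiegelSpace n) :
    (1 + (n : ℝ) ^ 2)⁻¹ ^ n * ∏ i, min ((imPart_posDef Z).isHermitian.eigenvalues i) 1 ≤
      ‖(denomMatrix (symplecticMap n (Int.castRingHom ℝ) γ) Z).det‖ := by
  refine le_trans ?_ (mul_norm_det_re_le _ Z)
  rw [mul_comm]
  refine mul_le_mul_of_nonneg_left (inv_pow_le_norm_det γ ?_)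
    (Finset.prod_nonneg fun i _ => le_min ((imPart_posDef Z).eigenvalues_pos i).le zero_le_one)
  ext i j
  have := congrFun (congrFun Z.2.1 i) j
  simpa using congrArg Complex.re this

/-! ### Growth of irreducible representations -/

/-- The QR decomposition. -/
theorem exists_unitary_blockTriangular {n : ℕ} (A : GL (Fin n) ℂ) : ∃ k b : GL (Fin n) ℂ,
    (k : Matrix (Fin n) (Fin n) ℂ) ∈ Matrix.unitaryGroup (Fin n) ℂ ∧
    (b : Matrix (Fin n) (Fin n) ℂ).BlockTriangular id ∧ A = k * b := by
  set f : Fin n → EuclideanSpace ℂ (Fin n) := fun j => WithLp.toLp 2 fun i => A i j with hf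
  have hcard : Module.finrank ℂ (EuclideanSpace ℂ (Fin n)) = Fintype.card (Fin n) := by simp
  set q := InnerProductSpace.gramSchmidtOrthonormalBasis hcard f with hq
  set U := (EuclideanSpace.basisFun (Fin n) ℂ).toBasis.toMatrix q with hU
  have hmem : U ∈ Matrix.unitaryGroup (Fin n) ℂ :=
    (EuclideanSpace.basisFun (Fin n) ℂ).toMatrix_orthonormalBasis_mem_unitary q
  have hUU : U * star U = 1 := Unitary.mul_star_self_of_mem hmem
  have hUU' : star U * U = 1 := Unitary.star_mul_self_of_mem hmem
  refine ⟨⟨U, star U, hUU, hUU'⟩, ⟨star U, U, hUU', hUU⟩ * A, hmem, ?_, ?_⟩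
  · intro i j hij
    have h := InnerProductSpace.gramSchmidtOrthonormalBasis_inv_triangular hcard f
      (show j < i from hij)
    rw [← hq] at h
    rw [← h]
    simp [hU, hf, Matrix.mul_apply, Module.Basis.toMatrix_apply, Matrix.star_apply,
      PiLp.inner_apply, mul_comm]
  · rw [← mul_assoc]
    convert (one_mul A).symm
    exact Units.ext hUU

theorem norm_det_of_mem_unitaryGroup {n : ℕ} {k : Matrix (Fin n) (Fin n) ℂ}
    (hk : k ∈ Matrix.unitaryGroup (Fin n) ℂ) : ‖k.det‖ = 1 := by
  have h := congrArg norm (Unitary.star_mul_self_of_mem (Matrix.det_of_mem_unitary hk))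
  rw [norm_mul, norm_star, norm_one] at h
  nlinarith [norm_nonneg k.det]

theorem apply_self_mul_inv_apply_self {n : ℕ} (b : GL (Fin n) ℂ)
    (hb : (b : Matrix (Fin n) (Fin n) ℂ).BlockTriangular id) (i : Fin n) :
    (b : Matrix (Fin n) (Fin n) ℂ) i i * ((b⁻¹ : GL (Fin n) ℂ) : Matrix (Fin n) (Fin n) ℂ) i i
      = 1 := by
  have hinv : ((b⁻¹ : GL (Fin n) ℂ) : Matrix (Fin n) (Fin n) ℂ).BlockTriangular id := by
    have := b.invertible
    rw [Matrix.coe_units_inv]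
    exact blockTriangular_inv_of_blockTriangular hb
  have h : ((b * b⁻¹ : GL (Fin n) ℂ) : Matrix (Fin n) (Fin n) ℂ) i i = 1 := by
    rw [mul_inv_cancel]; simp
  rw [Units.val_mul, Matrix.mul_apply, Finset.sum_eq_single i] at h
  · exact h
  · intro j _ hj
    rcases lt_or_gt_of_ne hj with hj | hj
    · rw [hb (show (id j : Fin n) < id i from hj), zero_mul]
    · rw [hinv (show (id i : Fin n) < id j from hj), mul_zero]
  · simp

section Rep

variable {n : ℕ} [NeZero n] {V : Type*} [NormedAddCommGroup V] [InnerProductSpace ℂ V]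
  [FiniteDimensional ℂ V] {ρ : Representation ℂ (GL (Fin n) ℂ) V}

omit [NeZero n] [FiniteDimensional ℂ V] in
theorem norm_apply_unitary
    (hinner : ∀ U : GL (Fin n) ℂ, (U : Matrix (Fin n) (Fin n) ℂ) ∈ Matrix.unitaryGroup (Fin n) ℂ →
      ∀ v w : V, inner ℂ (ρ U v) (ρ U w) = inner ℂ v w)
    {U : GL (Fin n) ℂ} (hU : (U : Matrix (Fin n) (Fin n) ℂ) ∈ Matrix.unitaryGroup (Fin n) ℂ)
    (v : V) : ‖ρ U v‖ = ‖v‖ := by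
  rw [@norm_eq_sqrt_re_inner ℂ, @norm_eq_sqrt_re_inner ℂ _ _ _ _ v, hinner U hU]

-- Write hg = kb with k unitary and b upper triangular. The entries of b⁻¹ = g⁻¹h⁻¹k are bounded by
-- some R, so |b_ii|^{λ_i} ≤ R^{λ₁-λ_i} |b_ii|^{λ₁} because λ_i ≤ λ₁. The product of the |b_ii| is
-- |det h||det g|.
omit [FiniteDimensional ℂ V] in
theorem norm_highestWeight_translate_le
    (hinner : ∀ U : GL (Fin n) ℂ, (U : Matrix (Fin n) (Fin n) ℂ) ∈ Matrix.unitaryGroup (Fin n) ℂ →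
      ∀ v w : V, inner ℂ (ρ U v) (ρ U w) = inner ℂ v w)
    {lam : Fin n → ℤ} (hdom : Antitone lam) {v : V}
    (hv : ∀ g : GL (Fin n) ℂ, (g : Matrix (Fin n) (Fin n) ℂ).BlockTriangular id →
      ρ g v = (∏ i, (g : Matrix (Fin n) (Fin n) ℂ) i i ^ lam i) • v)
    (K : ℝ) (g : GL (Fin n) ℂ) : ∃ C : ℝ, ∀ h : GL (Fin n) ℂ,
      (∀ i j, ‖((h⁻¹ : GL (Fin n) ℂ) : Matrix (Fin n) (Fin n) ℂ) i j‖ ≤ K) →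
        ‖ρ h (ρ g v)‖ ≤ C * ‖(h : Matrix (Fin n) (Fin n) ℂ).det‖ ^ lam 0 := by
  set S := ∑ i, ∑ j, ‖((g⁻¹ : GL (Fin n) ℂ) : Matrix (Fin n) (Fin n) ℂ) i j‖ with hS
  set R : ℝ := 1 + n * S * |K| with hR
  have hS0 : 0 ≤ S := by positivity
  have hR1 : 1 ≤ R := by rw [hR]; linarith [show 0 ≤ n * S * |K| by positivity]
  refine ⟨(∏ i, R ^ (lam 0 - lam i)) * ‖(g : Matrix (Fin n) (Fin n) ℂ).det‖ ^ lam 0 * ‖v‖,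
    fun h hh => ?_⟩
  obtain ⟨k, b, hk, hb, hkb⟩ := exists_unitary_blockTriangular (h * g)
  have hinv : ((b⁻¹ : GL (Fin n) ℂ) : Matrix (Fin n) (Fin n) ℂ) =
      ((g⁻¹ : GL (Fin n) ℂ) : Matrix (Fin n) (Fin n) ℂ) *
        ((h⁻¹ : GL (Fin n) ℂ) : Matrix (Fin n) (Fin n) ℂ) * k := by
    rw [← Units.val_mul, ← Units.val_mul]
    congr 1
    rw [← _root_.mul_inv_rev, hkb, _root_.mul_inv_rev, inv_mul_cancel_right]
  have hbinv : ∀ i, ‖((b⁻¹ : GL (Fin n) ℂ) : Matrix (Fin n) (Fin n) ℂ) i i‖ ≤ R := by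
    intro i
    rw [hinv, Matrix.mul_apply]
    simp only [Matrix.mul_apply, Finset.sum_mul]
    calc _ ≤ ∑ j : Fin n, ∑ l, ‖((g⁻¹ : GL (Fin n) ℂ) : Matrix (Fin n) (Fin n) ℂ) i l‖ * |K| := by
          refine (norm_sum_le _ _).trans (Finset.sum_le_sum fun j _ => ?_)
          refine (norm_sum_le _ _).trans (Finset.sum_le_sum fun l _ => ?_)
          rw [norm_mul, norm_mul]
          have h1 := entry_norm_bound_of_unitary hk j i
          have h2 := (hh l j).trans (le_abs_self K)
          calc _ ≤ ‖((g⁻¹ : GL (Fin n) ℂ) : Matrix (Fin n) (Fin n) ℂ) i l‖ * |K| * 1 := by gcongr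
            _ = _ := mul_one _
      _ = n * (∑ l, ‖((g⁻¹ : GL (Fin n) ℂ) : Matrix (Fin n) (Fin n) ℂ) i l‖) * |K| := by
          simp [Finset.sum_mul, mul_assoc]
      _ ≤ n * S * |K| := by
          gcongr
          exact Finset.single_le_sum (f := fun i => ∑ j,
            ‖((g⁻¹ : GL (Fin n) ℂ) : Matrix (Fin n) (Fin n) ℂ) i j‖)
            (fun i _ => by positivity) (Finset.mem_univ i)
      _ ≤ R := by rw [hR]; linarith
  have hdiag : ∀ i, ‖(b : Matrix (Fin n) (Fin n) ℂ) i i ^ lam i‖ ≤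
      R ^ (lam 0 - lam i) * ‖(b : Matrix (Fin n) (Fin n) ℂ) i i‖ ^ lam 0 := by
    intro i
    have h1 := congrArg norm (apply_self_mul_inv_apply_self b hb i)
    rw [norm_mul, norm_one] at h1
    have h0 : 0 < ‖(b : Matrix (Fin n) (Fin n) ℂ) i i‖ := by
      refine norm_pos_iff.2 fun h0 => ?_
      rw [h0, norm_zero, zero_mul] at h1
      exact zero_ne_one h1
    have h2 : ‖(b : Matrix (Fin n) (Fin n) ℂ) i i‖⁻¹ ≤ R := by
      rw [← eq_inv_of_mul_eq_one_right h1]; exact hbinv i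
    obtain ⟨m, hm⟩ := Int.eq_ofNat_of_zero_le (sub_nonneg.2 (hdom (Fin.zero_le i)))
    rw [norm_zpow, show lam i = -(lam 0 - lam i) + lam 0 by ring, zpow_add₀ h0.ne',
      show lam 0 - (-(lam 0 - lam i) + lam 0) = lam 0 - lam i by ring, hm, _root_.zpow_neg,
      ← _root_.inv_zpow, zpow_natCast, zpow_natCast]
    gcongr
  have hdet : ∏ i, ‖(b : Matrix (Fin n) (Fin n) ℂ) i i‖ =
      ‖(h : Matrix (Fin n) (Fin n) ℂ).det‖ * ‖(g : Matrix (Fin n) (Fin n) ℂ).det‖ := by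
    rw [← norm_prod, ← Matrix.det_of_isUpperTriangular hb, ← norm_mul, ← Matrix.det_mul,
      ← Units.val_mul, hkb, Units.val_mul, Matrix.det_mul, norm_mul,
      norm_det_of_mem_unitaryGroup hk, one_mul]
  rw [← Module.End.mul_apply, ← map_mul, hkb, map_mul, Module.End.mul_apply,
    norm_apply_unitary hinner hk, hv b hb, norm_smul, norm_prod]
  calc (∏ i, ‖(b : Matrix (Fin n) (Fin n) ℂ) i i ^ lam i‖) * ‖v‖
      ≤ (∏ i, R ^ (lam 0 - lam i) * ‖(b : Matrix (Fin n) (Fin n) ℂ) i i‖ ^ lam 0) * ‖v‖ := by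
        gcongr with i
        exact hdiag i
    _ = _ := by
        rw [Finset.prod_mul_distrib, Finset.prod_zpow, hdet, mul_zpow]
        ring

omit [NeZero n] [FiniteDimensional ℂ V] in
theorem span_translates_eq_top (hirr : ρ.IsIrreducible) {v : V} (hv : v ≠ 0) :
    Submodule.span ℂ (Set.range fun g => ρ g v) = ⊤ := by
  let W : Subrepresentation ρ := ⟨Submodule.span ℂ (Set.range fun g => ρ g v), by
    intro g w hw
    induction hw using Submodule.span_induction with
    | mem x hx =>
      obtain ⟨h, rfl⟩ := hx
      refine Submodule.subset_span ⟨g * h, ?_⟩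
      simp only [map_mul, Module.End.mul_apply]
    | zero => simp
    | add x y _ _ hx hy => rw [map_add]; exact Submodule.add_mem _ hx hy
    | smul c x _ hx => rw [map_smul]; exact Submodule.smul_mem _ _ hx⟩
  have hvW : v ∈ W.toSubmodule := Submodule.subset_span ⟨1, by simp⟩
  rcases hirr.eq_bot_or_eq_top W with h | h
  · rw [h] at hvW
    exact absurd ((Submodule.mem_bot ℂ).1 hvW) hv
  · exact congrArg Subrepresentation.toSubmodule h

/-- If the entries of `h⁻¹` are bounded, then `ρ(h)` grows at most like a power of the determinant,
the exponent being the largest entry of the highest weight. -/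
theorem exists_norm_le_det_zpow (hirr : ρ.IsIrreducible)
    (hinner : ∀ U : GL (Fin n) ℂ, (U : Matrix (Fin n) (Fin n) ℂ) ∈ Matrix.unitaryGroup (Fin n) ℂ →
      ∀ v w : V, inner ℂ (ρ U v) (ρ U w) = inner ℂ v w)
    {lam : Fin n → ℤ} (hdom : Antitone lam) (hlam : IsHighestWeight ρ lam) (K : ℝ) :
    ∃ C : ℝ, ∀ h : GL (Fin n) ℂ,
      (∀ i j, ‖((h⁻¹ : GL (Fin n) ℂ) : Matrix (Fin n) (Fin n) ℂ) i j‖ ≤ K) →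
        ∀ x : V, ‖ρ h x‖ ≤ C * ‖(h : Matrix (Fin n) (Fin n) ℂ).det‖ ^ lam 0 * ‖x‖ := by
  obtain ⟨v, hv0, hv⟩ := hlam
  have key : ∀ x : V, ∃ C : ℝ, ∀ h : GL (Fin n) ℂ,
      (∀ i j, ‖((h⁻¹ : GL (Fin n) ℂ) : Matrix (Fin n) (Fin n) ℂ) i j‖ ≤ K) →
        ‖ρ h x‖ ≤ C * ‖(h : Matrix (Fin n) (Fin n) ℂ).det‖ ^ lam 0 := by
    intro x
    have hx : x ∈ Submodule.span ℂ (Set.range fun g => ρ g v) := by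
      rw [span_translates_eq_top hirr hv0]; trivial
    induction hx using Submodule.span_induction with
    | mem x hx =>
      obtain ⟨g, rfl⟩ := hx
      exact norm_highestWeight_translate_le hinner hdom hv K g
    | zero => exact ⟨0, fun h _ => by simp⟩
    | add x y _ _ hx hy =>
      obtain ⟨C, hC⟩ := hx
      obtain ⟨D, hD⟩ := hy
      refine ⟨C + D, fun h hh => ?_⟩
      rw [map_add, add_mul]
      exact (norm_add_le _ _).trans (add_le_add (hC h hh) (hD h hh))
    | smul c x _ hx =>
      obtain ⟨C, hC⟩ := hx
      refine ⟨‖c‖ * C, fun h hh => ?_⟩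
      rw [map_smul, norm_smul, mul_assoc]
      exact mul_le_mul_of_nonneg_left (hC h hh) (norm_nonneg _)
  -- So far the constant depends on the vector. Expanding in a basis makes it uniform, coordinate
  -- functionals being bounded in finite dimension.
  choose c hc using key
  set B := Module.finBasis ℂ V
  refine ⟨∑ i, ‖LinearMap.toContinuousLinearMap (B.coord i)‖ * c (B i), fun h hh x => ?_⟩
  conv_lhs => rw [← B.sum_repr x, map_sum]
  rw [Finset.sum_mul, Finset.sum_mul]
  refine (norm_sum_le _ _).trans (Finset.sum_le_sum fun i _ => ?_)
  rw [map_smul, norm_smul]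
  have h1 := (LinearMap.toContinuousLinearMap (B.coord i)).le_opNorm x
  have h2 := hc (B i) h hh
  calc ‖B.repr x i‖ * ‖ρ h (B i)‖ ≤ (‖LinearMap.toContinuousLinearMap (B.coord i)‖ * ‖x‖) *
        (c (B i) * ‖(h : Matrix (Fin n) (Fin n) ℂ).det‖ ^ lam 0) :=
        mul_le_mul h1 h2 (norm_nonneg _) (by positivity)
    _ = _ := by ring

end Rep

/-! ### Boundedness from the Fourier expansion -/

/-- Testing the form on e_i ± e_j gives 2|W_ij| ≤ W_ii + W_jj. -/
theorem abs_apply_le_trace {n : ℕ} {W : Matrix (Fin n) (Fin n) ℝ} (hW : W.PosSemidef)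
    (i j : Fin n) : |W i j| ≤ W.trace := by
  have hd : ∀ i, 0 ≤ W i i := fun i => hW.diag_nonneg
  have hle : ∀ i, W i i ≤ W.trace := fun i =>
    Finset.single_le_sum (f := fun i => W i i) (fun i _ => hd i) (Finset.mem_univ i)
  have hsym : W j i = W i j := by simpa using hW.1.apply i j
  have h1 := hW.dotProduct_mulVec_nonneg (Pi.single i 1 + Pi.single j 1)
  have h2 := hW.dotProduct_mulVec_nonneg (Pi.single i 1 - Pi.single j 1)
  simp [Matrix.mulVec_add, Matrix.mulVec_sub, add_dotProduct, sub_dotProduct, hsym] at h1 h2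
  rw [abs_le]
  constructor <;> linarith [hle i, hle j]

/-- Each inverse eigenvalue of Y is at most Tr(Y⁻¹), so all eigenvalues of Y are at least C⁻¹. -/
theorem trace_mul_ge {n : ℕ} {S Y : Matrix (Fin n) (Fin n) ℝ} (hS : S.PosSemidef)
    (hY : Y.PosDef) {C : ℝ} (h : Y⁻¹.trace ≤ C) : C⁻¹ * S.trace ≤ (S * Y).trace := by
  set Q := (hY.isHermitian.eigenvectorUnitary : Matrix (Fin n) (Fin n) ℝ) with hQ
  set μ := hY.isHermitian.eigenvalues with hμ
  have h1 : Q * Qᵀ = 1 := eigenvectorUnitary_mul_transpose hY.isHermitian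
  have h2 : Qᵀ * Q = 1 := transpose_mul_eigenvectorUnitary hY.isHermitian
  have hYe : Y = Q * diagonal μ * Qᵀ := eq_eigenvectorUnitary_mul hY.isHermitian
  have hpos : ∀ i, 0 < μ i := hY.eigenvalues_pos
  have hinv : Y⁻¹ = Q * diagonal (fun i => (μ i)⁻¹) * Qᵀ := by
    refine Matrix.inv_eq_right_inv ?_
    rw [hYe]
    calc Q * diagonal μ * Qᵀ * (Q * diagonal (fun i => (μ i)⁻¹) * Qᵀ)
        = Q * diagonal μ * (Qᵀ * Q) * diagonal (fun i => (μ i)⁻¹) * Qᵀ := by noncomm_ring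
      _ = Q * (diagonal μ * diagonal (fun i => (μ i)⁻¹)) * Qᵀ := by rw [h2]; noncomm_ring
      _ = 1 := by
        rw [diagonal_mul_diagonal]
        simp only [mul_inv_cancel₀ (hpos _).ne', diagonal_one, mul_one, h1]
  have hμC : ∀ i, C⁻¹ ≤ μ i := by
    intro i
    rw [hinv, Matrix.trace_mul_comm, ← Matrix.mul_assoc, h2, Matrix.one_mul, trace_diagonal] at h
    have h3 := Finset.single_le_sum (f := fun i => (μ i)⁻¹)
      (fun i _ => (inv_pos.2 (hpos i)).le) (Finset.mem_univ i)
    exact inv_le_of_inv_le₀ (hpos i) (h3.trans h)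
  have hT : (Qᵀ * S * Q).PosSemidef := by
    have := hS.conjTranspose_mul_mul_same Q
    rwa [conjTranspose_eq_transpose_of_trivial] at this
  have e1 : S.trace = ∑ i, (Qᵀ * S * Q) i i := by
    change _ = (Qᵀ * S * Q).trace
    rw [Matrix.trace_mul_comm, ← Matrix.mul_assoc, h1, Matrix.one_mul]
  have e2 : (S * Y).trace = ∑ i, (Qᵀ * S * Q) i i * μ i := by
    have : (S * Y).trace = (Qᵀ * S * Q * diagonal μ).trace := by
      rw [hYe, ← Matrix.mul_assoc, Matrix.trace_mul_comm]
      simp only [Matrix.mul_assoc]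
    rw [this]
    simp [Matrix.trace, Matrix.mul_diagonal]
  rw [e1, e2, Finset.mul_sum]
  refine Finset.sum_le_sum fun i _ => ?_
  rw [mul_comm]
  exact mul_le_mul_of_nonneg_left (hμC i) hT.diag_nonneg

theorem norm_fourierExp {n : ℕ} (S : Matrix (Fin n) (Fin n) ℝ) (Z : SiegelSpace n) :
    ‖fourierExp S Z‖ = Real.exp (-(2 * Real.pi * (S * imPart Z).trace)) := by
  have h : ((S.map ((↑) : ℝ → ℂ) * (Z : Matrix (Fin n) (Fin n) ℂ)).trace).im
      = (S * imPart Z).trace := by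
    simp [Matrix.trace, Matrix.mul_apply, imPart]
  rw [fourierExp, Complex.norm_exp, ← h]
  simp [mul_assoc]

theorem abs_entryMonomial_le {n : ℕ} {V W : Matrix (Fin n) (Fin n) ℝ}
    (h : ∀ i j, |V i j| ≤ W i j) (b : UpperIndex n → ℕ) :
    |entryMonomial V b| ≤ |entryMonomial W b| := by
  rw [entryMonomial, entryMonomial, Finset.abs_prod, Finset.abs_prod]
  refine Finset.prod_le_prod (fun _ _ => abs_nonneg _) fun q _ => ?_
  rw [abs_pow, abs_pow]
  exact pow_le_pow_left₀ (abs_nonneg _) ((h _ _).trans (le_abs_self _)) _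

/-- A point dominating, term by term, the Fourier series at all points with bounded `Tr(Y⁻¹)`. -/
theorem exists_dominating_point (n : ℕ) {C : ℝ} (hC : 0 < C) : ∃ Z₀ : SiegelSpace n,
    (∀ i j, C ≤ (imPart Z₀)⁻¹ i j) ∧
    ∀ S : Matrix (Fin n) (Fin n) ℝ, S.PosSemidef → (S * imPart Z₀).trace ≤ C⁻¹ * S.trace := by
  set J : Matrix (Fin n) (Fin n) ℝ := vecMulVec (fun _ => 1) (fun _ => 1) with hJ
  have hJpos : J.PosSemidef := by
    simpa using posSemidef_vecMulVec_self_star (fun _ : Fin n => (1 : ℝ))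
  have hJJ : J * J = (n : ℝ) • J := by
    ext i j; simp [hJ, Matrix.mul_apply, vecMulVec_apply]
  -- `W` is to be the inverse of the imaginary part. A scalar matrix would not do: its off-diagonal
  -- zeros would kill monomials. Adding the all-ones matrix makes every entry at least `C`, while
  -- the inverse stays below C⁻¹ times the identity.
  set W : Matrix (Fin n) (Fin n) ℝ := C • (1 + J) with hW
  set Y : Matrix (Fin n) (Fin n) ℝ := C⁻¹ • (1 - ((n : ℝ) + 1)⁻¹ • J) with hY
  have hn : (n : ℝ) + 1 ≠ 0 := by positivity
  have hYW : Y * W = 1 := by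
    rw [hY, hW, smul_mul_smul_comm, inv_mul_cancel₀ hC.ne', one_smul, sub_mul, mul_add, mul_add,
      smul_mul_assoc, smul_mul_assoc, hJJ, smul_smul, one_mul, mul_one, one_mul]
    have : J = ((n : ℝ) + 1)⁻¹ • J + (((n : ℝ) + 1)⁻¹ * n) • J := by
      rw [← add_smul]
      rw [show ((n : ℝ) + 1)⁻¹ + ((n : ℝ) + 1)⁻¹ * n = 1 by field_simp; ring, one_smul]
    nth_rewrite 1 [this]
    abel
  have hWpos : W.PosDef := (PosDef.one.add_posSemidef hJpos).smul hC
  have hYinv : Y = W⁻¹ := (Matrix.inv_eq_left_inv hYW).symm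
  have hYpos : Y.PosDef := hYinv ▸ hWpos.inv
  have him : (Complex.I • Y.map ((↑) : ℝ → ℂ)).map Complex.im = Y := by ext i j; simp
  refine ⟨⟨Complex.I • Y.map (↑), ?_, by rw [him]; exact hYpos⟩, ?_, ?_⟩
  · have := hYpos.isHermitian
    rw [Matrix.IsHermitian, conjTranspose_eq_transpose_of_trivial] at this
    rw [transpose_smul, ← transpose_map, this]
  · intro i j
    rw [imPart, him, Matrix.inv_eq_right_inv hYW, hW]
    simp only [Matrix.smul_apply, Matrix.add_apply, hJ, vecMulVec_apply, smul_eq_mul, mul_one]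
    have : (0 : ℝ) ≤ (1 : Matrix (Fin n) (Fin n) ℝ) i j := by
      rw [Matrix.one_apply]; split_ifs <;> norm_num
    nlinarith
  · intro S hS
    rw [imPart, him, hY, mul_smul_comm, mul_sub, mul_one, trace_smul, trace_sub, smul_eq_mul]
    refine mul_le_mul_of_nonneg_left ?_ (inv_pos.2 hC).le
    rw [mul_smul_comm, trace_smul, smul_eq_mul, sub_le_self_iff]
    refine mul_nonneg (by positivity) ?_
    have := hS.dotProduct_mulVec_nonneg (fun _ => 1)
    rw [hJ, Matrix.mul_vecMulVec, trace_vecMulVec, dotProduct_comm]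
    simpa using this

/-- At the dominating point both the exponential and the monomial in Y⁻¹ are at least as large in
absolute value, for every S ≥ 0 and every exponent. The bound is the sum of the norms of the terms
there. -/
theorem HasNiceFourierExpansion.exists_bound {n p : ℕ} {f : SiegelSpace n → ℂ}
    (hf : HasNiceFourierExpansion p f) (C : ℝ) :
    ∃ B : ℝ, ∀ Z, (imPart Z)⁻¹.trace ≤ C → ‖f Z‖ ≤ B := by
  obtain ⟨N, -, a, hsum, hunif⟩ := hf
  obtain ⟨Z₀, h1, h2⟩ := exists_dominating_point n (C := max C 1) (by positivity)
  refine ⟨∑' q : exponents n p × fourierIndex n N,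
    ‖a q.1 q.2 * fourierExp (q.2 : Matrix (Fin n) (Fin n) ℝ) Z₀ *
      (entryMonomial (imPart Z₀)⁻¹ (q.1 : UpperIndex n → ℕ) : ℂ)‖, fun Z hZ => ?_⟩
  have hs := (hunif {Z} isCompact_singleton).hasSum (Set.mem_singleton Z)
  rw [← hs.tsum_eq]
  refine tsum_of_norm_bounded (hsum Z₀).hasSum fun q => ?_
  have hS : (q.2 : Matrix (Fin n) (Fin n) ℝ).PosSemidef := q.2.2.2
  have hZ' : (imPart Z)⁻¹.trace ≤ max C 1 := hZ.trans (le_max_left _ _)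
  rw [norm_mul, norm_mul, norm_mul, norm_mul, Complex.norm_real, Complex.norm_real,
    norm_fourierExp, norm_fourierExp]
  gcongr ‖_‖ * Real.exp (-(2 * Real.pi * ?_)) * ?_
  · exact (h2 _ hS).trans (trace_mul_ge hS (imPart_posDef Z) hZ')
  · exact abs_entryMonomial_le (fun i j =>
      ((abs_apply_le_trace (imPart_posDef Z).inv.posSemidef i j).trans hZ').trans (h1 i j)) _

/-- The same for functions with values in a finite dimensional space. -/
theorem exists_norm_bound {n p : ℕ} {V : Type*} [NormedAddCommGroup V] [InnerProductSpace ℂ V]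
    [FiniteDimensional ℂ V] {F : SiegelSpace n → V}
    (hF : ∀ l : Module.Dual ℂ V, HasNiceFourierExpansion p fun Z => l (F Z)) (C : ℝ) :
    ∃ B : ℝ, ∀ Z, (imPart Z)⁻¹.trace ≤ C → ‖F Z‖ ≤ B := by
  set e := Module.finBasis ℂ V
  choose B hB using fun i => (hF (e.coord i)).exists_bound C
  refine ⟨∑ i, B i * ‖e i‖, fun Z hZ => ?_⟩
  conv_lhs => rw [← e.sum_repr (F Z)]
  refine (norm_sum_le _ _).trans (Finset.sum_le_sum fun i _ => ?_)
  rw [norm_smul]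
  exact mul_le_mul_of_nonneg_right (hB i Z hZ) (norm_nonneg _)

/-! ### The slash operator -/

theorem blocks_mul {n : ℕ} (g h : symplecticGroup (Fin n) ℝ) :
    blockA (g * h) = blockA g * blockA h + blockB g * blockC h ∧
    blockB (g * h) = blockA g * blockB h + blockB g * blockD h ∧
    blockC (g * h) = blockC g * blockA h + blockD g * blockC h ∧
    blockD (g * h) = blockC g * blockB h + blockD g * blockD h := by
  refine ⟨?_, ?_, ?_, ?_⟩ <;> ext i j <;>
    simp [blockA, blockB, blockC, blockD, toBlocks₁₁, toBlocks₁₂, toBlocks₂₁, toBlocks₂₂,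
      Matrix.mul_apply, Fintype.sum_sum_type]

theorem coe_moebius_mul_denomMatrix {n : ℕ} (h : symplecticGroup (Fin n) ℝ) (Z : SiegelSpace n) :
    (moebius h Z : Matrix (Fin n) (Fin n) ℂ) * denomMatrix h Z = numMatrix h Z := by
  have hd := (Matrix.isUnit_iff_isUnit_det _).1 (isUnit_denomMatrix h Z)
  change numMatrix h Z * (denomMatrix h Z)⁻¹ * denomMatrix h Z = _
  rw [mul_assoc, Matrix.nonsing_inv_mul _ hd, mul_one]

theorem denomMatrix_mul {n : ℕ} (g h : symplecticGroup (Fin n) ℝ) (Z : SiegelSpace n) :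
    denomMatrix (g * h) Z = denomMatrix g (moebius h Z) * denomMatrix h Z := by
  obtain ⟨-, -, h3, h4⟩ := blocks_mul g h
  have e : denomMatrix g (moebius h Z) * denomMatrix h Z
      = blockC g * numMatrix h Z + blockD g * denomMatrix h Z := by
    rw [← coe_moebius_mul_denomMatrix h Z, denomMatrix, add_mul, mul_assoc]
  rw [e, denomMatrix, h3, h4, numMatrix, denomMatrix]
  noncomm_ring

theorem numMatrix_mul {n : ℕ} (g h : symplecticGroup (Fin n) ℝ) (Z : SiegelSpace n) :
    numMatrix (g * h) Z = numMatrix g (moebius h Z) * denomMatrix h Z := by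
  obtain ⟨h1, h2, -, -⟩ := blocks_mul g h
  have e : numMatrix g (moebius h Z) * denomMatrix h Z
      = blockA g * numMatrix h Z + blockB g * denomMatrix h Z := by
    rw [← coe_moebius_mul_denomMatrix h Z, numMatrix, add_mul, mul_assoc]
  rw [e, numMatrix, h1, h2, numMatrix, denomMatrix]
  noncomm_ring

theorem moebius_mul {n : ℕ} (g h : symplecticGroup (Fin n) ℝ) (Z : SiegelSpace n) :
    moebius (g * h) Z = moebius g (moebius h Z) := by
  have hd := (Matrix.isUnit_iff_isUnit_det _).1 (isUnit_denomMatrix h Z)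
  refine Subtype.ext ?_
  change numMatrix (g * h) Z * (denomMatrix (g * h) Z)⁻¹ =
    numMatrix g (moebius h Z) * (denomMatrix g (moebius h Z))⁻¹
  rw [numMatrix_mul, denomMatrix_mul, Matrix.mul_inv_rev, mul_assoc, ← mul_assoc (denomMatrix h Z),
    Matrix.mul_nonsing_inv _ hd, one_mul]

theorem autFactor_mul {n : ℕ} (g h : symplecticGroup (Fin n) ℝ) (Z : SiegelSpace n) :
    autFactor (g * h) Z = autFactor g (moebius h Z) * autFactor h Z :=
  Units.ext (denomMatrix_mul g h Z)

theorem slash_mul {n : ℕ} {V : Type*} [AddCommGroup V] [Module ℂ V]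
    (ρ : Representation ℂ (GL (Fin n) ℂ) V) (F : SiegelSpace n → V)
    (g h : symplecticGroup (Fin n) ℝ) : slash ρ F (g * h) = slash ρ (slash ρ F g) h := by
  funext Z
  rw [slash, slash, slash, moebius_mul, autFactor_mul, _root_.mul_inv_rev, map_mul,
    Module.End.mul_apply]

theorem imPart_moebius {n : ℕ} (g : symplecticGroup (Fin n) ℝ) (Z : SiegelSpace n) :
    (imPart (moebius g Z)).map ((↑) : ℝ → ℂ) =
      ((denomMatrix g Z)⁻¹)ᴴ * (imPart Z).map ((↑) : ℝ → ℂ) * (denomMatrix g Z)⁻¹ := by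
  have hd := (Matrix.isUnit_iff_isUnit_det _).1 (isUnit_denomMatrix g Z)
  have hdH : IsUnit (denomMatrix g Z)ᴴ.det := by rw [Matrix.det_conjTranspose]; exact hd.star
  have h2I : (2 * Complex.I) ≠ 0 := by simp
  apply smul_right_injective _ h2I
  simp only
  rw [imPart, ← sub_conjTranspose_eq (moebius g Z).2.1, ← Matrix.smul_mul, ← Matrix.mul_smul]
  rw [show (2 * Complex.I) • (imPart Z).map ((↑) : ℝ → ℂ) = _ from
    (sub_conjTranspose_eq Z.2.1).symm, ← denom_num_conjTranspose g Z]
  change numMatrix g Z * (denomMatrix g Z)⁻¹ - (numMatrix g Z * (denomMatrix g Z)⁻¹)ᴴ = _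
  rw [Matrix.conjTranspose_mul, Matrix.conjTranspose_nonsing_inv, Matrix.mul_sub, Matrix.sub_mul,
    ← Matrix.mul_assoc, Matrix.nonsing_inv_mul _ hdH, Matrix.one_mul,
    Matrix.mul_assoc, Matrix.mul_assoc, Matrix.mul_nonsing_inv _ hd, Matrix.mul_one]

/-- The trace of `Im(gZ)⁻¹` is the sum of squares of the entries of `(CZ+D)Y^{-1/2}`. -/
theorem trace_inv_imPart_moebius {n : ℕ} (g : symplecticGroup (Fin n) ℝ) (Z : SiegelSpace n) :
    (imPart (moebius g Z))⁻¹.trace = ∑ i, ∑ j, ‖(denomMatrix g Z *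
      (((posDefSqrt (imPart Z) (imPart_posDef Z))⁻¹ : GL (Fin n) ℂ) :
        Matrix (Fin n) (Fin n) ℂ)) i j‖ ^ 2 := by
  obtain ⟨h1, h2⟩ := posDefSqrt_mul_conjTranspose (imPart Z) (imPart_posDef Z)
  set s : GL (Fin n) ℂ := posDefSqrt (imPart Z) (imPart_posDef Z)
  set Y' := imPart (moebius g Z)
  set h : GL (Fin n) ℂ := s * (autFactor g Z)⁻¹ with hh
  have hJ : ((autFactor g Z)⁻¹ : GL (Fin n) ℂ) = ((denomMatrix g Z)⁻¹ : Matrix (Fin n) (Fin n) ℂ) :=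
    Matrix.coe_units_inv _
  have hinv : ((h⁻¹ : GL (Fin n) ℂ) : Matrix (Fin n) (Fin n) ℂ)
      = denomMatrix g Z * ((s⁻¹ : GL (Fin n) ℂ) : Matrix (Fin n) (Fin n) ℂ) := by
    rw [hh, _root_.mul_inv_rev, inv_inv, Units.val_mul]
    rfl
  -- Hence Y'⁻¹ = h⁻¹(h⁻¹)*, whose trace is the squared Hilbert–Schmidt norm of h⁻¹.
  have hY' : Y'.map ((↑) : ℝ → ℂ) = (h : Matrix (Fin n) (Fin n) ℂ)ᴴ * h := by
    rw [imPart_moebius, hh, Units.val_mul, conjTranspose_mul, h1, hJ, ← h2]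
    noncomm_ring
  have hu : IsUnit Y'.det := (Matrix.isUnit_iff_isUnit_det _).1 (imPart_posDef _).isUnit
  have hYi : Y'⁻¹.map ((↑) : ℝ → ℂ) = ((h⁻¹ : GL (Fin n) ℂ) : Matrix (Fin n) (Fin n) ℂ) *
      ((h⁻¹ : GL (Fin n) ℂ) : Matrix (Fin n) (Fin n) ℂ)ᴴ := by
    have e1 : Y'.map ((↑) : ℝ → ℂ) * Y'⁻¹.map ((↑) : ℝ → ℂ) = 1 := by
      have := congrArg (Complex.ofRealHom.mapMatrix (m := Fin n)) (Matrix.mul_nonsing_inv Y' hu)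
      rw [map_mul, map_one] at this
      exact this
    rw [← Matrix.inv_eq_right_inv e1, hY', Matrix.mul_inv_rev, ← Matrix.conjTranspose_nonsing_inv,
      Matrix.coe_units_inv]
  have e := congrArg Matrix.trace hYi
  rw [← hinv]
  have e2 : (Y'⁻¹.map ((↑) : ℝ → ℂ)).trace = ((Y'⁻¹.trace : ℝ) : ℂ) := by
    simp [Matrix.trace]
  rw [e2] at e
  have e3 : ((∑ i, ∑ j, ‖((h⁻¹ : GL (Fin n) ℂ) : Matrix (Fin n) (Fin n) ℂ) i j‖ ^ 2 : ℝ) : ℂ)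
      = (((h⁻¹ : GL (Fin n) ℂ) : Matrix (Fin n) (Fin n) ℂ) *
      ((h⁻¹ : GL (Fin n) ℂ) : Matrix (Fin n) (Fin n) ℂ)ᴴ).trace := by
    simp only [Matrix.trace, Matrix.diag_apply, Matrix.mul_apply, conjTranspose_apply,
      Complex.star_def, Complex.mul_conj, Complex.normSq_eq_norm_sq]
    push_cast
    rfl
  rw [← e3] at e
  exact_mod_cast e

/-- The finitely many translates of `F` are uniformly bounded on the reduced points. -/
theorem exists_uniform_bound {n : ℕ} {V : Type*} [NormedAddCommGroup V] [InnerProductSpace ℂ V]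
    [FiniteDimensional ℂ V] {ρ : Representation ℂ (GL (Fin n) ℂ) V} {F : SiegelSpace n → V}
    (hF : F ∈ nearlyHolomorphicForms ρ) (C : ℝ) :
    ∃ B : ℝ, ∀ g ∈ integralSymplectic n, ∀ Z, (imPart Z)⁻¹.trace ≤ C →
      ‖slash ρ F (ratToReal n g⁻¹) Z‖ ≤ B := by
  obtain ⟨Γ, ⟨hcomm, -⟩, p, hform⟩ := hF
  have hfin : (Γ.subgroupOf (integralSymplectic n)).FiniteIndex := ⟨hcomm.1⟩
  choose B hB using fun q : integralSymplectic n ⧸ Γ.subgroupOf (integralSymplectic n) =>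
    exists_norm_bound (fun l => hform.fourier ((q.out : symplecticGroup (Fin n) ℚ)⁻¹) l) C
  obtain ⟨M, hM⟩ := (Set.finite_range B).bddAbove
  refine ⟨M, fun g hg Z hZ => ?_⟩
  obtain ⟨h, hh⟩ := QuotientGroup.mk_out_eq_mul (Γ.subgroupOf (integralSymplectic n)) ⟨g, hg⟩
  have hmem : ((h : integralSymplectic n) : symplecticGroup (Fin n) ℚ)⁻¹ ∈ Γ :=
    Γ.inv_mem (Subgroup.mem_subgroupOf.1 h.2)
  -- The function F|g⁻¹ depends only on the coset of g modulo Γ: the representative is gh with h in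
  -- Γ, and F|h⁻¹ = F.
  have e : slash ρ F (ratToReal n g⁻¹) = slash ρ F (ratToReal n
      ((QuotientGroup.mk (s := Γ.subgroupOf (integralSymplectic n)) ⟨g, hg⟩).out :
        symplecticGroup (Fin n) ℚ)⁻¹) := by
    rw [hh, Subgroup.coe_mul, _root_.mul_inv_rev, map_mul, slash_mul, hform.invariant _ hmem]
  rw [e]
  exact (hB _ Z hZ).trans (hM ⟨_, rfl⟩)

/-! ### From powers of the determinant to the eigenvalues of Y -/

theorem one_le_rpow_add_rpow_neg {μ : ℝ} (hμ : 0 < μ) (x : ℝ) : 1 ≤ μ ^ x + μ ^ (-x) := by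
  have h1 : 0 < μ ^ x := Real.rpow_pos_of_pos hμ x
  rw [Real.rpow_neg hμ.le]
  rcases le_total 1 (μ ^ x) with h | h
  · linarith [inv_pos.2 h1]
  · linarith [(one_le_inv₀ h1).2 h]

/-- The quotient equals max(μ^{1/2}, μ^{-1/2}). -/
theorem sqrt_div_min_pow_le {μ : ℝ} (hμ : 0 < μ) (m : ℕ) :
    (Real.sqrt μ / min μ 1) ^ m ≤ μ ^ ((m : ℝ) / 2) + μ ^ (-((m : ℝ) / 2)) := by
  have hm : ∀ x : ℝ, (μ ^ x) ^ m = μ ^ (m * x) := fun x => by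
    rw [mul_comm, Real.rpow_mul_natCast hμ.le]
  rcases le_total μ 1 with h | h
  · rw [min_eq_left h]
    have e : Real.sqrt μ / μ = μ ^ (-(1 / 2) : ℝ) := by
      rw [Real.rpow_neg hμ.le, ← Real.sqrt_eq_rpow, Real.sqrt_div_self']
      simp
    rw [e, hm, show (m : ℝ) * -(1 / 2) = -(m / 2) by ring]
    linarith [Real.rpow_pos_of_pos hμ ((m : ℝ) / 2)]
  · rw [min_eq_right h, div_one, Real.sqrt_eq_rpow, hm, show (m : ℝ) * (1 / 2) = m / 2 by ring]
    linarith [Real.rpow_pos_of_pos hμ (-((m : ℝ) / 2))]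

theorem norm_det_posDefSqrt {n : ℕ} (Y : Matrix (Fin n) (Fin n) ℝ) (hY : Y.PosDef) :
    ‖(posDefSqrt Y hY : Matrix (Fin n) (Fin n) ℂ).det‖ =
      ∏ i, Real.sqrt (hY.isHermitian.eigenvalues i) := by
  have h := congrArg (fun M => ‖Matrix.det M‖) (posDefSqrt_mul_conjTranspose Y hY).2
  have e : (Y.map ((↑) : ℝ → ℂ)).det = ((Y.det : ℝ) : ℂ) := (Complex.ofRealHom.map_det Y).symm
  have hd := hY.isHermitian.det_eq_prod_eigenvalues
  simp only [RCLike.ofReal_real_eq_id, id] at hd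
  simp only [Matrix.det_mul, norm_mul, e, Complex.norm_real, Real.norm_eq_abs,
    abs_of_pos hY.det_pos] at h
  have h2 : (∏ i, Real.sqrt (hY.isHermitian.eigenvalues i)) *
      (∏ i, Real.sqrt (hY.isHermitian.eigenvalues i)) = Y.det := by
    rw [← Finset.prod_mul_distrib, hd]
    exact Finset.prod_congr rfl fun i _ => Real.mul_self_sqrt (hY.eigenvalues_pos i).le
  exact (mul_self_inj (norm_nonneg _) (Finset.prod_nonneg fun i _ => Real.sqrt_nonneg _)).1
    (h.trans h2.symm)

/-- The power of the determinant in the growth of `ρ(Y^{1/2}J⁻¹)`, expressed in the eigenvalues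
of `Y`. -/
theorem exists_norm_det_zpow_le (n : ℕ) (k : ℤ) (K : ℝ) : ∃ D : ℝ, ∀ (Z : SiegelSpace n)
    (γ : symplecticGroup (Fin n) ℤ) (h : GL (Fin n) ℂ),
    h = posDefSqrt (imPart Z) (imPart_posDef Z) *
      (autFactor (symplecticMap n (Int.castRingHom ℝ) γ) Z)⁻¹ →
    (∀ i j, ‖((h⁻¹ : GL (Fin n) ℂ) : Matrix (Fin n) (Fin n) ℂ) i j‖ ≤ K) →
    ‖(h : Matrix (Fin n) (Fin n) ℂ).det‖ ^ k ≤ D * ∏ i,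
      ((imPart_posDef Z).isHermitian.eigenvalues i ^ ((k : ℝ) / 2) +
        (imPart_posDef Z).isHermitian.eigenvalues i ^ (-((k : ℝ) / 2))) := by
  rcases le_total 0 k with hk | hk
  · obtain ⟨m, rfl⟩ := Int.eq_ofNat_of_zero_le hk
    set c : ℝ := (1 + (n : ℝ) ^ 2)⁻¹ ^ n with hc
    have hc0 : 0 < c := by positivity
    refine ⟨c⁻¹ ^ m, fun Z γ h hh _ => ?_⟩
    have hpos := (imPart_posDef Z).eigenvalues_pos
    have h1 := prod_min_le_norm_det_denomMatrix γ Z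
    rw [← hc] at h1
    have hP : 0 < ∏ i, min ((imPart_posDef Z).isHermitian.eigenvalues i) 1 :=
      Finset.prod_pos fun i _ => lt_min (hpos i) one_pos
    have hdet : ‖(h : Matrix (Fin n) (Fin n) ℂ).det‖ ≤ c⁻¹ *
        ∏ i, (Real.sqrt ((imPart_posDef Z).isHermitian.eigenvalues i) /
          min ((imPart_posDef Z).isHermitian.eigenvalues i) 1) := by
      have e : ((autFactor (symplecticMap n (Int.castRingHom ℝ) γ) Z)⁻¹ : GL (Fin n) ℂ) =
          ((denomMatrix (symplecticMap n (Int.castRingHom ℝ) γ) Z)⁻¹ :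
            Matrix (Fin n) (Fin n) ℂ) := Matrix.coe_units_inv _
      rw [hh, Units.val_mul, Matrix.det_mul, norm_mul, norm_det_posDefSqrt, e, Matrix.det_nonsing_inv,
        Ring.inverse_eq_inv', norm_inv, Finset.prod_div_distrib]
      rw [← div_eq_mul_inv, inv_mul_eq_div, div_div, mul_comm _ c]
      refine div_le_div_of_nonneg_left (Finset.prod_nonneg fun i _ => Real.sqrt_nonneg _)
        (mul_pos hc0 hP) h1
    rw [zpow_natCast]
    refine (pow_le_pow_left₀ (norm_nonneg _) hdet m).trans ?_
    rw [mul_pow, ← Finset.prod_pow]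
    refine mul_le_mul_of_nonneg_left ?_ (by positivity)
    refine Finset.prod_le_prod (fun i _ => ?_) fun i _ => ?_
    · exact pow_nonneg (div_nonneg (Real.sqrt_nonneg _) (le_min (hpos i).le zero_le_one)) _
    · simpa using sqrt_div_min_pow_le (hpos i) m
  · obtain ⟨m, hm⟩ := Int.eq_ofNat_of_zero_le (neg_nonneg.2 hk)
    -- For a nonpositive exponent only an upper bound for |det h⁻¹| is needed, given by the Leibniz
    -- expansion; every factor of the product over eigenvalues is at least 1.
    refine ⟨(n.factorial • |K| ^ n) ^ m, fun Z γ h _ hK => ?_⟩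
    have hpos := (imPart_posDef Z).eigenvalues_pos
    have h1 : ‖((h⁻¹ : GL (Fin n) ℂ) : Matrix (Fin n) (Fin n) ℂ).det‖ ≤ n.factorial • |K| ^ n := by
      have := Matrix.det_le (A := ((h⁻¹ : GL (Fin n) ℂ) : Matrix (Fin n) (Fin n) ℂ))
        (abv := NormedField.toAbsoluteValue ℂ) (x := |K|)
        (fun i j => (hK i j).trans (le_abs_self K))
      rwa [Fintype.card_fin] at this
    have h2 : ‖(h : Matrix (Fin n) (Fin n) ℂ).det‖ ^ k =
        ‖((h⁻¹ : GL (Fin n) ℂ) : Matrix (Fin n) (Fin n) ℂ).det‖ ^ m := by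
      rw [Matrix.coe_units_inv, Matrix.det_nonsing_inv, Ring.inverse_eq_inv', norm_inv,
        ← zpow_natCast, ← hm, _root_.inv_zpow, _root_.zpow_neg, inv_inv]
    rw [h2]
    have h3 : (1 : ℝ) ≤ ∏ i, ((imPart_posDef Z).isHermitian.eigenvalues i ^ ((k : ℝ) / 2) +
        (imPart_posDef Z).isHermitian.eigenvalues i ^ (-((k : ℝ) / 2))) :=
      le_of_eq_of_le Finset.prod_const_one.symm (Finset.prod_le_prod (fun i _ => zero_le_one)
        fun i _ => one_le_rpow_add_rpow_neg (hpos i) _)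
    exact (pow_le_pow_left₀ (norm_nonneg _) h1 m).trans
      (le_mul_of_one_le_right (by positivity) h3)

theorem ratToReal_symplecticMap {n : ℕ} (γ : symplecticGroup (Fin n) ℤ) :
    ratToReal n (symplecticMap n (Int.castRingHom ℚ) γ) =
      symplecticMap n (Int.castRingHom ℝ) γ := by
  refine Subtype.ext ?_
  ext i j
  simp [ratToReal, symplecticMap]

end SiegelModular

/-! ### The growth estimate -/

theorem theorem3p1 (n : ℕ) [NeZero n] {V : Type*} [NormedAddCommGroup V] [InnerProductSpace ℂ V]
    [FiniteDimensional ℂ V] (ρ : Representation ℂ (Matrix.GeneralLinearGroup (Fin n) ℂ) V)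
    (hrat : SiegelModular.IsRational ρ) (hirr : ρ.IsIrreducible)
    (hinner : ∀ U : Matrix.GeneralLinearGroup (Fin n) ℂ,
      (U : Matrix (Fin n) (Fin n) ℂ) ∈ Matrix.unitaryGroup (Fin n) ℂ →
        ∀ v w : V, inner ℂ (ρ U v) (ρ U w) = inner ℂ v w)
    (lam : Fin n → ℤ) (hdom : Antitone lam) (hlam : SiegelModular.IsHighestWeight ρ lam)
    (F : SiegelModular.SiegelSpace n → V) (hF : F ∈ SiegelModular.nearlyHolomorphicForms ρ) :
    ∃ C : ℝ, ∀ Z : SiegelModular.SiegelSpace n,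
      ‖ρ (SiegelModular.posDefSqrt (SiegelModular.imPart Z) (SiegelModular.imPart_posDef Z)) (F Z)‖
        ≤ C * ∏ i : Fin n,
          ((SiegelModular.imPart_posDef Z).isHermitian.eigenvalues i ^ ((lam 0 : ℝ) / 2) +
            (SiegelModular.imPart_posDef Z).isHermitian.eigenvalues i ^ (-((lam 0 : ℝ) / 2))) := by
  open SiegelModular in
  obtain ⟨R, hR⟩ := exists_reduced_point n
  obtain ⟨B, hB⟩ := exists_uniform_bound hF R
  obtain ⟨C, hC⟩ := exists_norm_le_det_zpow hirr hinner hdom hlam (Real.sqrt R)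
  obtain ⟨D, hD⟩ := exists_norm_det_zpow_le n (lam 0) (Real.sqrt R)
  refine ⟨|C| * D * |B|, fun Z => ?_⟩
  obtain ⟨γ, hγ⟩ := hR Z
  set g := symplecticMap n (Int.castRingHom ℝ) γ with hg
  set s := posDefSqrt (imPart Z) (imPart_posDef Z) with hs
  set h : GL (Fin n) ℂ := s * (autFactor g Z)⁻¹ with hh
  have hentry : ∀ i j, ‖((h⁻¹ : GL (Fin n) ℂ) : Matrix (Fin n) (Fin n) ℂ) i j‖ ≤ Real.sqrt R := by
    intro i j
    refine Real.le_sqrt_of_sq_le (le_trans ?_ hγ)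
    have e : ((h⁻¹ : GL (Fin n) ℂ) : Matrix (Fin n) (Fin n) ℂ)
        = denomMatrix g Z * ((s⁻¹ : GL (Fin n) ℂ) : Matrix (Fin n) (Fin n) ℂ) := by
      rw [hh, _root_.mul_inv_rev, inv_inv, Units.val_mul]
      rfl
    rw [e]
    refine le_trans ?_ (Finset.single_le_sum (f := fun i => ∑ j, ‖(denomMatrix g Z *
      ((s⁻¹ : GL (Fin n) ℂ) : Matrix (Fin n) (Fin n) ℂ)) i j‖ ^ 2)
      (fun i _ => Finset.sum_nonneg fun j _ => sq_nonneg _) (Finset.mem_univ i))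
    exact Finset.single_le_sum (f := fun j => ‖(denomMatrix g Z *
      ((s⁻¹ : GL (Fin n) ℂ) : Matrix (Fin n) (Fin n) ℂ)) i j‖ ^ 2)
      (fun j _ => sq_nonneg _) (Finset.mem_univ j)
  have htr : (imPart (moebius g Z))⁻¹.trace ≤ R := (trace_inv_imPart_moebius g Z).trans_le hγ
  have hbound := hB _ ⟨γ, rfl⟩ _ htr
  -- Passing to γZ turns Y^{1/2} into h: the automorphy factor of γ joins the square root, leaving a
  -- translate of F at a reduced point.
  have hFZ : F Z = slash ρ (slash ρ F (ratToReal n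
      (symplecticMap n (Int.castRingHom ℚ) γ)⁻¹)) g Z := by
    obtain ⟨Γ, -, p, hform⟩ := hF
    rw [hg, ← ratToReal_symplecticMap, ← slash_mul, ← map_mul, inv_mul_cancel,
      hform.invariant 1 Γ.one_mem]
  rw [hFZ, slash, ← Module.End.mul_apply, ← map_mul, ← hh]
  refine (hC h hentry _).trans ?_
  have hDh := hD Z γ h hh hentry
  calc C * ‖(h : Matrix (Fin n) (Fin n) ℂ).det‖ ^ lam 0 * _
      ≤ |C| * (D * ∏ i, ((imPart_posDef Z).isHermitian.eigenvalues i ^ ((lam 0 : ℝ) / 2) +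
        (imPart_posDef Z).isHermitian.eigenvalues i ^ (-((lam 0 : ℝ) / 2)))) * |B| := by
        gcongr
        · exact mul_nonneg (abs_nonneg _)
            (le_trans (zpow_nonneg (norm_nonneg _) _) hDh)
        · exact le_abs_self C
        · exact hbound.trans (le_abs_self B)
    _ = _ := by ring
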